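/- Let $n\ge 3$, $\alpha,\beta\in\mathbb C$, $C\in\mathbb C^{(n-2)\times 2}$, $D\in\mathbb C^{2\times(n-2)}$, and \[ A=\begin{bmatrix}\alpha I_{n-2} & C\\ D & \beta I_2\end{bmatrix}\in\mathbb C^{n\times n},\qquad H=C^*C+DD^*,\qquad Z=DC . \] Let $W(A)=\{\langle Ax,x\rangle : x\in\mathbb C^n,\ \|x\|=1\}$ be the numerical range of $A$. Let $u_1,u_2$ be any orthonormal basis of $\mathbb C^2$ consisting of eigenvectors of $H$, with corresponding eigenvalues $h_1,h_2\in\mathbb R$; let $z_{ij}=\langle Zu_j,u_i\rangle$ be the entries of $Z$ in this basis, and let $z_1,z_2$ be the eigenvalues of $Z$, repeated according to algebraic multiplicity. Then $W(A)$ is the convex hull of a finite nonempty collection of ellipses, all centered at $(\alpha+\beta)/2$, if and only if at least one of the following conditions holds: (i) $Z$ is normal and commutes with $H$; (ii) $z_1=z_2$, and $Z$ and $H$ have a common eigenvector; (iii) $z_1\ne z_2$ and \[ -(h_1-h_2)^2\,\frac{z_{12}z_{21}}{(z_1-z_2)^2}=\bigl(|z_{12}|+|z_{21}|\bigr)^2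 . \] Here an ellipse may be degenerate: an ellipse centered at $c$ is a set $\{c+e^{i\varphi}(a\cos t+ i b\sin t): t\in\mathbb R\}$ with $\varphi\in\mathbb R$ and $a\ge b\ge 0$, so that a segment with midpoint $c$ ($b=0$) and the point $c$ ($a=b=0$) are included. -/

import Mathlib

/-- The numerical range `W(A)` of a square complex matrix: the set of all values `x* A x`
on the Euclidean unit sphere. (Mathlib's inner product is conjugate-linear in its first
argument, so `inner ℂ x (A x) = x* A x`.) -/
def numericalRange {n : Type*} [Fintype n] [DecidableEq n] (A : Matrix n n ℂ) : Set ℂ :=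
  {w : ℂ | ∃ x : EuclideanSpace ℂ n, ‖x‖ = 1 ∧ inner ℂ x (Matrix.toEuclideanLin A x) = w}

/-- The ellipse in the complex plane with centre `c`, half-axes `a` and `b`, and the axis of
half-length `a` parallel to `exp (i φ)`. For `b = 0` it degenerates into a line segment with
midpoint `c`, and for `a = b = 0` into the point `c`. -/
def ellipse (c : ℂ) (a b φ : ℝ) : Set ℂ :=
  Set.range fun t : ℝ =>
    c + Complex.exp ((φ : ℂ) * Complex.I) *
      (((a * Real.cos t : ℝ) : ℂ) + ((b * Real.sin t : ℝ) : ℂ) * Complex.I)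

/-- `E` is a (possibly degenerate) ellipse centred at `c`. -/
def IsEllipseCenteredAt (c : ℂ) (E : Set ℂ) : Prop :=
  ∃ a b φ : ℝ, 0 ≤ b ∧ b ≤ a ∧ E = ellipse c a b φ

/-- `S` is the convex hull of finitely many (at least one) ellipses, all centred at `c`. -/
def IsConvexHullOfEllipsesCenteredAt (c : ℂ) (S : Set ℂ) : Prop :=
  ∃ F : Set (Set ℂ), F.Finite ∧ F.Nonempty ∧ (∀ E ∈ F, IsEllipseCenteredAt c E) ∧
    S = convexHull ℝ (⋃₀ F)

/-- The block matrix with scalar diagonal blocks `α I`, `β I` and off-diagonal blocks `C`, `D`. -/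
def scalarDiagBlock {m k : ℕ} (α β : ℂ) (C : Matrix (Fin m) (Fin k) ℂ)
    (D : Matrix (Fin k) (Fin m) ℂ) : Matrix (Fin m ⊕ Fin k) (Fin m ⊕ Fin k) ℂ :=
  Matrix.fromBlocks (α • (1 : Matrix (Fin m) (Fin m) ℂ)) C D
    (β • (1 : Matrix (Fin k) (Fin k) ℂ))

/-- `H = C* C + D D*`. -/
def matH {m k : ℕ} (C : Matrix (Fin m) (Fin k) ℂ) (D : Matrix (Fin k) (Fin m) ℂ) :
    Matrix (Fin k) (Fin k) ℂ :=
  C.conjTranspose * C + D * D.conjTranspose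

/-- `Z = D C`. -/
def matZ {m k : ℕ} (C : Matrix (Fin m) (Fin k) ℂ) (D : Matrix (Fin k) (Fin m) ℂ) :
    Matrix (Fin k) (Fin k) ℂ :=
  D * C

/-- The matrices `X` and `Y` have a common eigenvector. -/
def ShareEigenvector {k : ℕ} (X Y : Matrix (Fin k) (Fin k) ℂ) : Prop :=
  ∃ (v : Fin k → ℂ) (s t : ℂ),
    Module.End.HasEigenvector (Matrix.toLin' X) s v ∧
    Module.End.HasEigenvector (Matrix.toLin' Y) t v

/-! A compact convex plane set is determined by its support function, so everything is read off from
support functions relative to the centre `(α + β) / 2`. In a direction `u` with `‖u‖ = 1`, the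
support function `s` of `W(A)` satisfies `4 s(u)² = 4 (Re (u (α - β) / 2))² + Λ(u)`, where `Λ(u)` is
the largest eigenvalue of `H + u² Z + (u² Z)ᴴ = NᴴN`, `N = u C + ū Dᴴ` (`isSupport_numericalRange`).
This pencil is 2 × 2, so `Λ = mean + √disc`, with `mean` and `disc` real trigonometric polynomials
in `v = u²`. For a centred ellipse, `4 s²` is of the form `P + Re (u² q)` with `‖q‖ ≤ P`, and every
such function occurs. The hull of finitely many ellipses has the maximum of their support functions
as its own. If `W(A)` is such a hull, one ellipse is touched in infinitely many directions. There
`√disc` equals some `X + Re (v Y)`, and comparing coefficients makes `disc = (X + Re (v Y))²` an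
identity (`IsSupport.discIsSquare`). Conversely, if `disc` is such a square, then `√disc = max (T,
-T)` with `T = X + Re (v Y)`, and two ellipses suffice; that they are genuine ellipses follows from
`NᴴN ≥ 0` (`IsSupport.isConvexHullOfEllipses`). It remains to solve the three coefficient equations
`DiscIsSquare`, which yields exactly (i), (ii) or (iii) (`discIsSquare_iff`). -/

section Auxiliary

open Complex Set Matrix

/-! ### Support functions of plane sets -/

/-- `s` is the support function of `S` relative to the point `c`, with the directions given by
unit complex numbers; the supremum is attained. -/
def IsSupport (c : ℂ) (S : Set ℂ) (s : ℂ → ℝ) : Prop :=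
  ∀ u : ℂ, ‖u‖ = 1 → IsGreatest ((fun w => (u * (w - c)).re) '' S) (s u)

lemma isLinearMap_re_mul (u : ℂ) : IsLinearMap ℝ fun w : ℂ => (u * w).re :=
  ⟨fun x y => by simp [mul_add], fun r x => by simp; ring⟩

lemma convex_re_mul_sub_lt (u c : ℂ) (r : ℝ) : Convex ℝ {w : ℂ | (u * (w - c)).re < r} := by
  have : {w : ℂ | (u * (w - c)).re < r} = {w : ℂ | (u * w).re < r + (u * c).re} := by
    ext w
    simp only [mem_ofPred_eq, mul_sub, sub_re]
    constructor <;> intro h <;> linarith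
  rw [this]
  exact convex_halfSpace_lt (isLinearMap_re_mul u) _

lemma convex_re_mul_sub_le (u c : ℂ) (r : ℝ) : Convex ℝ {w : ℂ | (u * (w - c)).re ≤ r} := by
  have : {w : ℂ | (u * (w - c)).re ≤ r} = {w : ℂ | (u * w).re ≤ r + (u * c).re} := by
    ext w
    simp only [mem_ofPred_eq, mul_sub, sub_re]
    constructor <;> intro h <;> linarith
  rw [this]
  exact convex_halfSpace_le (isLinearMap_re_mul u) _

lemma IsSupport.convexHull {c : ℂ} {S : Set ℂ} {s : ℂ → ℝ} (h : IsSupport c S s) :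
    IsSupport c (convexHull ℝ S) s := by
  intro u hu
  obtain ⟨⟨w, hw, hws⟩, hub⟩ := h u hu
  refine ⟨⟨w, subset_convexHull ℝ S hw, hws⟩, ?_⟩
  rintro _ ⟨x, hx, rfl⟩
  have hsub : S ⊆ {w : ℂ | (u * (w - c)).re ≤ s u} := fun y hy => hub ⟨y, hy, rfl⟩
  exact convexHull_min hsub (convex_re_mul_sub_le u c _) hx

lemma IsSupport.union {c : ℂ} {S T : Set ℂ} {s t : ℂ → ℝ} (hS : IsSupport c S s)
    (hT : IsSupport c T t) : IsSupport c (S ∪ T) fun u => max (s u) (t u) := by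
  intro u hu
  rw [image_union]
  exact (hS u hu).union (hT u hu)

/-- A value of the support function of a convex hull is attained on the set itself. -/
lemma IsSupport.exists_of_convexHull {c : ℂ} {S : Set ℂ} {s : ℂ → ℝ}
    (h : IsSupport c (_root_.convexHull ℝ S) s) {u : ℂ} (hu : ‖u‖ = 1) :
    ∃ w ∈ S, (u * (w - c)).re = s u := by
  obtain ⟨⟨w, hw, hws⟩, hub⟩ := h u hu
  -- Otherwise `S`, and with it its hull, lies in the open half-plane, which is convex.
  by_contra! hne
  have hsub : S ⊆ {w : ℂ | (u * (w - c)).re < s u} := fun y hy =>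
    lt_of_le_of_ne (hub ⟨y, subset_convexHull ℝ S hy, rfl⟩) (hne y hy)
  exact absurd hws (convexHull_min hsub (convex_re_mul_sub_lt u c _) hw).ne

/-- A point of `S` outside `T` would be strictly separated from `T` by a real functional; rescaled
to a unit direction, this contradicts the equality of the support values. -/
lemma IsSupport.subset {c : ℂ} {S T : Set ℂ} {s : ℂ → ℝ} (hS : IsSupport c S s)
    (hT : IsSupport c T s) (hc : Convex ℝ T) (hcl : IsClosed T) : S ⊆ T := by
  intro x hx
  by_contra hxT
  obtain ⟨f, r, hf, hr⟩ := geometric_hahn_banach_closed_point hc hcl hxT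
  -- The complex number representing `f` as `w ↦ Re (v w)`.
  set v : ℂ := ⟨f 1, -f I⟩ with hv
  have hfv : ∀ w : ℂ, f w = (v * w).re := by
    intro w
    have : f w = f (w.re • (1 : ℂ) + w.im • I) := by
      congr 1
      apply Complex.ext <;> simp
    rw [this, map_add, map_smul, map_smul]
    simp [hv]; ring
  have hv0 : v ≠ 0 := by
    intro h0
    obtain ⟨⟨w, hw, -⟩, -⟩ := hT 1 (by simp)
    have h1 := hf w hw
    rw [hfv, h0] at h1
    rw [hfv, h0] at hr
    simp at h1 hr
    linarith
  have hn : 0 < ‖v‖ := norm_pos_iff.mpr hv0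
  have hu : ‖((‖v‖⁻¹ : ℝ) : ℂ) * v‖ = 1 := by
    rw [norm_mul, norm_real, norm_inv, norm_norm]; exact inv_mul_cancel₀ hn.ne'
  have hre : ∀ w : ℂ, (((‖v‖⁻¹ : ℝ) : ℂ) * v * (w - c)).re = ‖v‖⁻¹ * (f w - f c) := by
    intro w
    rw [mul_assoc, re_ofReal_mul, ← map_sub, hfv]
  obtain ⟨⟨w, hw, hws⟩, -⟩ := hT _ hu
  have h1 := (hS _ hu).2 ⟨x, hx, rfl⟩
  simp only [hre] at hws h1
  rw [← hws] at h1
  have h2 := le_of_mul_le_mul_left h1 (inv_pos.mpr hn)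
  linarith [hf w hw]

lemma isSupport_eq {c : ℂ} {S T : Set ℂ} {s : ℂ → ℝ} (hS : IsSupport c S s)
    (hT : IsSupport c T s) (hSc : Convex ℝ S) (hScl : IsClosed S) (hTc : Convex ℝ T)
    (hTcl : IsClosed T) : S = T :=
  (hS.subset hT hTc hTcl).antisymm (hT.subset hS hSc hScl)

/-! ### Extremal values of binary forms on the unit circle -/

/-- Cauchy–Schwarz: `(a² - b², 2ab)` is again a unit vector, the one at the doubled angle. -/
lemma mul_sq_sub_sq_add_le {a b p q : ℝ} (h : a ^ 2 + b ^ 2 = 1) :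
    p * (a ^ 2 - b ^ 2) + 2 * q * (a * b) ≤ √(p ^ 2 + q ^ 2) := by
  apply Real.le_sqrt_of_sq_le
  have : p ^ 2 + q ^ 2 = (p ^ 2 + q ^ 2) * (a ^ 2 + b ^ 2) ^ 2 := by rw [h]; ring
  rw [this]
  nlinarith [sq_nonneg (q * (a ^ 2 - b ^ 2) - 2 * p * (a * b))]

/-- The half-angle formulas give the maximiser. Its entries are nonnegative when `q ≥ 0`, so they
can serve as norms of vectors. -/
lemma exists_mul_sq_sub_sq_add_eq (p : ℝ) {q : ℝ} (hq : 0 ≤ q) :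
    ∃ a b : ℝ, 0 ≤ a ∧ 0 ≤ b ∧ a ^ 2 + b ^ 2 = 1 ∧
      p * (a ^ 2 - b ^ 2) + 2 * q * (a * b) = √(p ^ 2 + q ^ 2) := by
  set r := √(p ^ 2 + q ^ 2) with hr
  have hr2 : r ^ 2 = p ^ 2 + q ^ 2 := Real.sq_sqrt (by positivity)
  rcases (Real.sqrt_nonneg (p ^ 2 + q ^ 2)).eq_or_lt with h0 | h0
  · rw [← hr] at h0
    rw [← h0] at hr2
    have hp : p = 0 := by nlinarith [sq_nonneg p, sq_nonneg q]
    have hq : q = 0 := by nlinarith [sq_nonneg p, sq_nonneg q]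
    exact ⟨1, 0, by norm_num, le_rfl, by norm_num, by rw [← h0, hp, hq]; ring⟩
  · rw [← hr] at h0
    have hpr : |p| ≤ r := Real.abs_le_sqrt (by nlinarith [sq_nonneg q])
    have h1 : 0 ≤ (1 + p / r) / 2 := by
      have : -1 ≤ p / r := by rw [le_div_iff₀ h0]; linarith [(abs_le.mp hpr).1]
      linarith
    have h2 : 0 ≤ (1 - p / r) / 2 := by
      have : p / r ≤ 1 := by rw [div_le_iff₀ h0]; linarith [(abs_le.mp hpr).2]
      linarith
    refine ⟨√((1 + p / r) / 2), √((1 - p / r) / 2), Real.sqrt_nonneg _, Real.sqrt_nonneg _, ?_, ?_⟩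
    · rw [Real.sq_sqrt h1, Real.sq_sqrt h2]; ring
    · have hab : √((1 + p / r) / 2) * √((1 - p / r) / 2) = q / (2 * r) := by
        rw [← Real.sqrt_mul h1, Real.sqrt_eq_iff_mul_self_eq (mul_nonneg h1 h2) (by positivity)]
        field_simp
        nlinarith
      rw [Real.sq_sqrt h1, Real.sq_sqrt h2, hab]
      field_simp
      nlinarith

/-! ### Ellipses -/

/-- The double-angle formula turns the squared support function of an ellipse into a trigonometric
polynomial in `u²`. -/
lemma sq_abs_exp_mul_I_mul (u e : ℂ) (hu : ‖u‖ = 1) (he : ‖e‖ = 1) (a b : ℝ) :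
    (a * (u * e).re) ^ 2 + (b * (u * e).im) ^ 2
      = (a ^ 2 + b ^ 2) / 2 + (u ^ 2 * (((a ^ 2 - b ^ 2) / 2 : ℝ) * e ^ 2)).re := by
  have h1 : (u * e).re ^ 2 + (u * e).im ^ 2 = 1 := by
    have : ‖u * e‖ ^ 2 = 1 := by rw [norm_mul, hu, he]; norm_num
    rw [← this, Complex.sq_norm, normSq_apply]; ring
  have h2 : (u ^ 2 * (((a ^ 2 - b ^ 2) / 2 : ℝ) * e ^ 2)).re
      = (a ^ 2 - b ^ 2) / 2 * ((u * e).re ^ 2 - (u * e).im ^ 2) := by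
    rw [show u ^ 2 * ((((a ^ 2 - b ^ 2) / 2 : ℝ) : ℂ) * e ^ 2)
      = (((a ^ 2 - b ^ 2) / 2 : ℝ) : ℂ) * ((u * e) * (u * e)) by ring, re_ofReal_mul, mul_re]
    ring
  rw [h2]
  linear_combination ((a ^ 2 + b ^ 2) / 2) * h1

lemma isSupport_ellipse (c : ℂ) (a b φ : ℝ) :
    IsSupport c (ellipse c a b φ) fun u =>
      √((a ^ 2 + b ^ 2) / 2
        + (u ^ 2 * (((a ^ 2 - b ^ 2) / 2 : ℝ) * Complex.exp (φ * I) ^ 2)).re) := by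
  intro u hu
  simp only
  rw [← sq_abs_exp_mul_I_mul u _ hu (norm_exp_ofReal_mul_I φ) a b]
  set v := u * Complex.exp (φ * I) with hv
  have key : ∀ t : ℝ, (u * (c + Complex.exp ((φ : ℂ) * Complex.I) *
      (((a * Real.cos t : ℝ) : ℂ) + ((b * Real.sin t : ℝ) : ℂ) * Complex.I) - c)).re
      = a * v.re * Real.cos t - b * v.im * Real.sin t := by
    intro t
    rw [add_sub_cancel_left, ← mul_assoc, ← hv]
    simp only [mul_re, add_re, add_im, ofReal_re, ofReal_im, I_re, I_im, mul_im]
    ring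
  constructor
  · obtain ⟨t, ht⟩ : ∃ t : ℝ, a * v.re * Real.cos t - b * v.im * Real.sin t
        = √((a * v.re) ^ 2 + (b * v.im) ^ 2) := by
      set z : ℂ := ⟨a * v.re, -(b * v.im)⟩ with hz
      have hzn : √((a * v.re) ^ 2 + (b * v.im) ^ 2) = ‖z‖ := by
        rw [Complex.norm_def, normSq_apply]
        simp only [hz]
        congr 1
        ring
      refine ⟨arg z, ?_⟩
      have h1 := Complex.norm_mul_cos_arg z
      have h2 := Complex.norm_mul_sin_arg z
      have h3 := Real.cos_sq_add_sin_sq (arg z)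
      rw [hzn]
      have h1' : a * v.re = ‖z‖ * Real.cos (arg z) := by rw [h1]
      have h2' : b * v.im = -(‖z‖ * Real.sin (arg z)) := by rw [h2]; simp [hz]
      rw [h1', h2']
      linear_combination ‖z‖ * h3
    exact ⟨_, ⟨t, rfl⟩, (key t).trans ht⟩
  · rintro _ ⟨_, ⟨t, rfl⟩, rfl⟩
    simp only [key]
    apply Real.le_sqrt_of_sq_le
    have h3 := Real.cos_sq_add_sin_sq t
    have : (a * v.re) ^ 2 + (b * v.im) ^ 2
        = ((a * v.re) ^ 2 + (b * v.im) ^ 2) * (Real.cos t ^ 2 + Real.sin t ^ 2) := by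
      rw [h3]; ring
    rw [this]
    nlinarith [sq_nonneg (a * v.re * Real.sin t + b * v.im * Real.cos t)]

/-- The affine image of the plane which carries the unit circle to `ellipse c a b φ`. -/
lemma exists_linearMap_ellipse (c : ℂ) (a b φ : ℝ) :
    ∃ f : ℂ →ₗ[ℝ] ℂ, ellipse c a b φ = (fun z => c + z) '' (f '' Metric.sphere (0 : ℂ) 1) := by
  refine ⟨⟨⟨fun z => Complex.exp ((φ : ℂ) * I) *
    (((a * z.re : ℝ) : ℂ) + ((b * z.im : ℝ) : ℂ) * I), ?_⟩, ?_⟩, ?_⟩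
  · intro x y; push_cast [add_re, add_im]; ring
  · intro r x; simp; ring
  · ext w
    simp only [ellipse, mem_range, mem_image, LinearMap.coe_mk, AddHom.coe_mk,
      exists_exists_and_eq_and, mem_sphere_zero_iff_norm]
    constructor
    · rintro ⟨t, rfl⟩
      refine ⟨Complex.exp (t * I), norm_exp_ofReal_mul_I t, ?_⟩
      rw [exp_ofReal_mul_I_re, exp_ofReal_mul_I_im]
    · rintro ⟨z, hz, rfl⟩
      refine ⟨arg z, ?_⟩
      have h1 := Complex.norm_mul_cos_arg z
      have h2 := Complex.norm_mul_sin_arg z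
      rw [hz, one_mul] at h1 h2
      rw [h1, h2]

-- The hull is an affine image of the closed unit disc. Compactness supplies the closedness needed
-- in `isSupport_eq`.
open scoped Pointwise in
lemma isCompact_convexHull_ellipse (c : ℂ) (a b φ : ℝ) :
    IsCompact (convexHull ℝ (ellipse c a b φ)) := by
  obtain ⟨f, hf⟩ := exists_linearMap_ellipse c a b φ
  have hadd : (fun z => c + z) '' (f '' Metric.sphere (0 : ℂ) 1)
      = c +ᵥ (f '' Metric.sphere (0 : ℂ) 1) := rfl
  rw [hf, hadd, convexHull_vadd, ← LinearMap.image_convexHull,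
    convexHull_sphere_eq_closedBall _ zero_le_one]
  exact ((isCompact_closedBall _ _).image f.continuous_of_finiteDimensional).vadd c

lemma ellipse_nonempty (c : ℂ) (a b φ : ℝ) : (ellipse c a b φ).Nonempty := range_nonempty _

lemma IsCompact.convexJoin {S T : Set ℂ} (hS : IsCompact S) (hT : IsCompact T) :
    IsCompact (convexJoin ℝ S T) := by
  have : _root_.convexJoin ℝ S T = (fun p : ℝ × ℂ × ℂ => (1 - p.1) • p.2.1 + p.1 • p.2.2) ''
      (Icc (0 : ℝ) 1 ×ˢ (S ×ˢ T)) := by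
    ext w
    simp only [mem_convexJoin, segment_eq_image, mem_image, Prod.exists, mem_prod]
    constructor
    · rintro ⟨a, ha, b, hb, t, ht, rfl⟩
      exact ⟨t, a, b, ⟨ht, ha, hb⟩, rfl⟩
    · rintro ⟨t, a, b, ⟨ht, ha, hb⟩, rfl⟩
      exact ⟨a, ha, b, hb, t, ht, rfl⟩
  rw [this]
  exact (isCompact_Icc.prod (hS.prod hT)).image (by fun_prop)

lemma isCompact_convexHull_union {S T : Set ℂ} (hS : IsCompact (convexHull ℝ S))
    (hT : IsCompact (convexHull ℝ T)) (hS0 : S.Nonempty) (hT0 : T.Nonempty) :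
    IsCompact (convexHull ℝ (S ∪ T)) := by
  rw [convexHull_union hS0 hT0]
  exact hS.convexJoin hT

/-! ### The Toeplitz–Hausdorff theorem -/

section ToeplitzHausdorff

variable {E : Type*} [NormedAddCommGroup E] [InnerProductSpace ℂ E]

/-- With the phase `e` chosen well, the form is real along the segment from `x` to `e • y`; its
normalised value runs continuously from 0 to 1, and the intermediate value theorem applies. -/
lemma exists_unit_inner_eq_of_zero_one (A : E →ₗ[ℂ] E) {x y : E} (hx : ‖x‖ = 1) (hy : ‖y‖ = 1)
    (hx0 : inner ℂ x (A x) = 0) (hy1 : inner ℂ y (A y) = 1) {t : ℝ} (ht : t ∈ Icc (0 : ℝ) 1) :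
    ∃ z : E, ‖z‖ = 1 ∧ inner ℂ z (A z) = t := by
  -- a unimodular factor makes the cross terms real
  obtain ⟨e, he, hre⟩ : ∃ e : ℂ, ‖e‖ = 1 ∧
      (e * inner ℂ x (A y) + (starRingEnd ℂ) e * inner ℂ y (A x)).im = 0 := by
    set p := inner ℂ x (A y)
    set q := inner ℂ y (A x)
    set v : ℂ := p - (starRingEnd ℂ) q with hv
    have him : ∀ e : ℂ, (e * p + (starRingEnd ℂ) e * q).im = (e * v).im := by
      intro e
      simp [hv]; ring
    by_cases h0 : v = 0
    · exact ⟨1, by simp, by rw [him, h0]; simp⟩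
    · have hn : (‖v‖ : ℂ) ≠ 0 := by simpa using h0
      refine ⟨(starRingEnd ℂ) v / ‖v‖, ?_, ?_⟩
      · rw [norm_div, RCLike.norm_conj, norm_real, norm_norm, div_self (by simpa using h0)]
      · rw [him, div_mul_eq_mul_div, Complex.conj_mul', pow_two, mul_div_assoc, div_self hn]
        simp
  set z : ℝ → E := fun s => (((1 - s : ℝ) : ℂ)) • x + ((s : ℂ) * e) • y with hz
  -- If the path met zero, `x` and `y` would be proportional and give the same value of the form,
  -- but 0 ≠ 1.
  have hz0 : ∀ s, z s ≠ 0 := by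
    intro s hs
    have hxy : ((1 - s : ℝ) : ℂ) • x = -(((s : ℂ) * e) • y) := eq_neg_of_add_eq_zero_left hs
    have hs1 : |1 - s| = |s| := by
      have := congrArg norm hxy
      rwa [norm_neg, norm_smul, norm_smul, hx, hy, norm_mul, he, mul_one, mul_one, mul_one,
        norm_real, norm_real] at this
    have hs2 : (1 - s : ℝ) ≠ 0 := by
      intro h
      rw [h, abs_zero] at hs1
      have : s = 0 := abs_eq_zero.mp hs1.symm
      linarith
    have hA : inner ℂ (((1 - s : ℝ) : ℂ) • x) (A (((1 - s : ℝ) : ℂ) • x))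
        = inner ℂ (((s : ℂ) * e) • y) (A (((s : ℂ) * e) • y)) := by
      rw [hxy, map_neg, inner_neg_neg]
    rw [map_smul, map_smul, inner_smul_left, inner_smul_right, inner_smul_left, inner_smul_right,
      hx0, hy1] at hA
    have : ((s : ℂ) * e) = 0 := by
      rw [mul_zero, mul_zero, mul_one, Complex.conj_mul'] at hA
      simpa using hA.symm
    have he0 : e ≠ 0 := by rintro rfl; simp at he
    have hs0 : s = 0 := by simpa [he0] using this
    rw [hs0] at hs1
    norm_num at hs1
  have hval : ∀ s, (inner ℂ (z s) (A (z s))).im = 0 := by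
    intro s
    have : inner ℂ (z s) (A (z s)) = ((s * (1 - s) : ℝ) : ℂ)
        * (e * inner ℂ x (A y) + (starRingEnd ℂ) e * inner ℂ y (A x)) + ((s ^ 2 : ℝ) : ℂ) := by
      have he2 : (starRingEnd ℂ) e * e = 1 := by rw [Complex.conj_mul', he]; simp
      simp only [hz, map_add, map_smul, inner_add_left, inner_add_right, inner_smul_left,
        inner_smul_right, hx0, hy1, map_mul, conj_ofReal]
      push_cast
      linear_combination (s : ℂ) ^ 2 * he2
    rw [this, add_im, im_ofReal_mul, hre, ofReal_im]
    simp
  have hzc : Continuous z := by fun_prop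
  have hAc : Continuous fun s => A (z s) := by
    simp only [hz, map_add, map_smul]
    fun_prop
  set f : ℝ → ℝ := fun s => (inner ℂ (z s) (A (z s))).re / ‖z s‖ ^ 2 with hf
  have hfc : Continuous f := by
    apply Continuous.div
    · exact continuous_re.comp (hzc.inner hAc)
    · fun_prop
    · intro s; simpa using hz0 s
  have hf0 : f 0 = 0 := by simp [hf, hz, hx0]
  have hf1 : f 1 = 1 := by
    have he2 : (starRingEnd ℂ) e * e = 1 := by rw [Complex.conj_mul', he]; simp
    have h1 : z 1 = e • y := by simp [hz]
    simp only [hf]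
    rw [h1, map_smul, inner_smul_left, inner_smul_right, hy1, norm_smul, he, hy, mul_one, he2]
    simp
  obtain ⟨s, -, hs⟩ := intermediate_value_Icc zero_le_one hfc.continuousOn
    (by rw [hf0, hf1]; exact ht)
  have hn : ‖z s‖ ≠ 0 := by simpa using hz0 s
  refine ⟨((‖z s‖⁻¹ : ℝ) : ℂ) • z s, ?_, ?_⟩
  · rw [norm_smul, norm_real, norm_inv, norm_norm, inv_mul_cancel₀ hn]
  · rw [map_smul, inner_smul_left, inner_smul_right, conj_ofReal]
    have h1 : inner ℂ (z s) (A (z s)) = (((inner ℂ (z s) (A (z s))).re : ℝ) : ℂ) := by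
      apply Complex.ext <;> simp [hval]
    rw [h1, ← hs, hf]
    push_cast
    have : (‖z s‖ : ℂ) ≠ 0 := by simpa using hz0 s
    field_simp

/-- **Toeplitz–Hausdorff**: the numerical range is convex. -/
theorem convex_setOf_inner (A : E →ₗ[ℂ] E) :
    Convex ℝ {w : ℂ | ∃ x : E, ‖x‖ = 1 ∧ inner ℂ x (A x) = w} := by
  rw [convex_iff_segment_subset]
  rintro w₀ ⟨x, hx, rfl⟩ w₁ ⟨y, hy, rfl⟩ w hw
  rw [segment_eq_image'] at hw
  obtain ⟨t, ht, rfl⟩ := hw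
  set p := inner ℂ x (A x)
  set q := inner ℂ y (A y)
  by_cases hpq : q - p = 0
  · exact ⟨x, hx, by simp [hpq, p]⟩
  · set B : E →ₗ[ℂ] E := (q - p)⁻¹ • (A - p • LinearMap.id) with hB
    have hBv : ∀ v : E, ‖v‖ = 1 → inner ℂ v (B v) = (q - p)⁻¹ * (inner ℂ v (A v) - p) := by
      intro v hv
      simp [hB, inner_self_eq_norm_sq_to_K, hv]
    obtain ⟨z, hz, hzt⟩ := exists_unit_inner_eq_of_zero_one B hx hy
      (by rw [hBv x hx]; simp [p]) (by rw [hBv y hy]; exact inv_mul_cancel₀ hpq) ht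
    refine ⟨z, hz, ?_⟩
    rw [hBv z hz, inv_mul_eq_iff_eq_mul₀ hpq] at hzt
    simp only [real_smul]
    linear_combination hzt

lemma isCompact_setOf_inner [FiniteDimensional ℂ E] (A : E →ₗ[ℂ] E) :
    IsCompact {w : ℂ | ∃ x : E, ‖x‖ = 1 ∧ inner ℂ x (A x) = w} := by
  have : {w : ℂ | ∃ x : E, ‖x‖ = 1 ∧ inner ℂ x (A x) = w}
      = (fun x => inner ℂ x (A x)) '' Metric.sphere (0 : E) 1 := by
    ext w; simp
  have := FiniteDimensional.proper ℂ E
  rw [‹{w : ℂ | _} = _›]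
  exact (isCompact_sphere _ _).image
    (continuous_id.inner A.continuous_of_finiteDimensional)

end ToeplitzHausdorff

/-! ### The support function of the numerical range -/

lemma mem_numericalRange_scalarDiagBlock {m k : ℕ} (α β : ℂ) (C : Matrix (Fin m) (Fin k) ℂ)
    (D : Matrix (Fin k) (Fin m) ℂ) (w : ℂ) :
    w ∈ numericalRange (scalarDiagBlock α β C D) ↔
      ∃ (f : EuclideanSpace ℂ (Fin m)) (g : EuclideanSpace ℂ (Fin k)), ‖f‖ ^ 2 + ‖g‖ ^ 2 = 1 ∧
        α * (‖f‖ ^ 2 : ℝ) + β * (‖g‖ ^ 2 : ℝ) + inner ℂ f (toEuclideanLin C g)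
          + inner ℂ g (toEuclideanLin D f) = w := by
  have key : ∀ (f : EuclideanSpace ℂ (Fin m)) (g : EuclideanSpace ℂ (Fin k)),
      ‖(WithLp.toLp 2 (Sum.elim f.ofLp g.ofLp) : EuclideanSpace ℂ (Fin m ⊕ Fin k))‖ ^ 2
        = ‖f‖ ^ 2 + ‖g‖ ^ 2 ∧
      inner ℂ (WithLp.toLp 2 (Sum.elim f.ofLp g.ofLp) : EuclideanSpace ℂ (Fin m ⊕ Fin k))
        (toEuclideanLin (scalarDiagBlock α β C D) (WithLp.toLp 2 (Sum.elim f.ofLp g.ofLp)))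
        = α * (‖f‖ ^ 2 : ℝ) + β * (‖g‖ ^ 2 : ℝ) + inner ℂ f (toEuclideanLin C g)
          + inner ℂ g (toEuclideanLin D f) := by
    intro f g
    constructor
    · simp [EuclideanSpace.norm_sq_eq]
    · have hf : ((‖f‖ ^ 2 : ℝ) : ℂ) = inner ℂ f f := by
        rw [inner_self_eq_norm_sq_to_K]; push_cast; rfl
      have hg : ((‖g‖ ^ 2 : ℝ) : ℂ) = inner ℂ g g := by
        rw [inner_self_eq_norm_sq_to_K]; push_cast; rfl
      rw [hf, hg]
      simp only [EuclideanSpace.inner_eq_star_dotProduct, toLpLin_apply, scalarDiagBlock,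
        fromBlocks_mulVec, Sum.elim_comp_inl, Sum.elim_comp_inr]
      simp only [dotProduct, Fintype.sum_sum_type, Sum.elim_inl, Sum.elim_inr, Pi.star_apply,
        Pi.add_apply, smul_mulVec, one_mulVec, Pi.smul_apply, smul_eq_mul, add_mul,
        Finset.sum_add_distrib, Finset.mul_sum, mul_assoc]
      ring
  constructor
  · rintro ⟨x, hx, rfl⟩
    have hxe : x = WithLp.toLp 2 (Sum.elim
        (WithLp.toLp 2 (x.ofLp ∘ Sum.inl) : EuclideanSpace ℂ (Fin m)).ofLp
        (WithLp.toLp 2 (x.ofLp ∘ Sum.inr) : EuclideanSpace ℂ (Fin k)).ofLp) := by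
      simp
    refine ⟨WithLp.toLp 2 (x.ofLp ∘ Sum.inl), WithLp.toLp 2 (x.ofLp ∘ Sum.inr), ?_, ?_⟩
    · rw [← (key _ _).1, ← hxe, hx, one_pow]
    · rw [← (key _ _).2, ← hxe]
  · rintro ⟨f, g, hfg, rfl⟩
    refine ⟨_, ?_, (key f g).2⟩
    rw [← sq_eq_sq₀ (norm_nonneg _) zero_le_one, (key f g).1, hfg, one_pow]

lemma norm_sq_toEuclideanLin {m k : ℕ} (M : Matrix (Fin m) (Fin k) ℂ)
    (g : EuclideanSpace ℂ (Fin k)) :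
    ((‖toEuclideanLin M g‖ ^ 2 : ℝ) : ℂ) = star g.ofLp ⬝ᵥ ((Mᴴ * M) *ᵥ g.ofLp) := by
  have : ((‖toEuclideanLin M g‖ ^ 2 : ℝ) : ℂ)
      = inner ℂ (toEuclideanLin M g) (toEuclideanLin M g) := by
    rw [inner_self_eq_norm_sq_to_K]; push_cast; rfl
  rw [this, EuclideanSpace.inner_eq_star_dotProduct, toLpLin_apply, dotProduct_comm, star_mulVec,
    ← dotProduct_mulVec, mulVec_mulVec]

lemma norm_toEuclideanLin_unitary {U : Matrix (Fin 2) (Fin 2) ℂ}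
    (hU : U ∈ unitaryGroup (Fin 2) ℂ) (g : EuclideanSpace ℂ (Fin 2)) :
    ‖toEuclideanLin U g‖ = ‖g‖ := by
  have h1 : Uᴴ * U = 1 := mem_unitaryGroup_iff'.mp hU
  have h2 := norm_sq_toEuclideanLin U g
  have h3 := norm_sq_toEuclideanLin (1 : Matrix (Fin 2) (Fin 2) ℂ) g
  rw [h1] at h2
  rw [conjTranspose_one, one_mul, ← h2] at h3
  have h4 : ‖g‖ ^ 2 = ‖toEuclideanLin U g‖ ^ 2 := by
    have : toEuclideanLin (1 : Matrix (Fin 2) (Fin 2) ℂ) g = g := by simp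
    rw [this] at h3
    exact_mod_cast h3
  exact ((sq_eq_sq₀ (norm_nonneg _) (norm_nonneg _)).mp h4).symm

/-- Half the trace of `diag h + v ζ + (v ζ)ᴴ`. -/
noncomputable def pencilMean (h : Fin 2 → ℝ) (ζ : Matrix (Fin 2) (Fin 2) ℂ) (v : ℂ) : ℝ :=
  (h 0 + h 1) / 2 + (v * (ζ 0 0 + ζ 1 1)).re

/-- A quarter of the discriminant of the characteristic polynomial of
`diag h + v ζ + (v ζ)ᴴ`. -/
noncomputable def pencilDisc (h : Fin 2 → ℝ) (ζ : Matrix (Fin 2) (Fin 2) ℂ) (v : ℂ) : ℝ :=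
  ((h 0 - h 1) / 2 + (v * (ζ 0 0 - ζ 1 1)).re) ^ 2
    + ‖v * ζ 0 1 + (starRingEnd ℂ) (v * ζ 1 0)‖ ^ 2

lemma pencilDisc_nonneg (h : Fin 2 → ℝ) (ζ : Matrix (Fin 2) (Fin 2) ℂ) (v : ℂ) :
    0 ≤ pencilDisc h ζ v := by unfold pencilDisc; positivity

/-- The matrix `u C + ū D*`. -/
noncomputable def rotatedBlock {m k : ℕ} (C : Matrix (Fin m) (Fin k) ℂ)
    (D : Matrix (Fin k) (Fin m) ℂ) (u : ℂ) : Matrix (Fin m) (Fin k) ℂ :=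
  u • C + (starRingEnd ℂ) u • Dᴴ

/-- Since `ū u = 1`, the phase disappears from `Cᴴ C` and `D Dᴴ` and survives only as `u²` at `D C`
and its adjoint. -/
lemma conjTranspose_mul_rotatedBlock {m k : ℕ} (C : Matrix (Fin m) (Fin k) ℂ)
    (D : Matrix (Fin k) (Fin m) ℂ) {u : ℂ} (hu : ‖u‖ = 1) :
    (rotatedBlock C D u)ᴴ * rotatedBlock C D u
      = matH C D + u ^ 2 • matZ C D + (u ^ 2 • matZ C D)ᴴ := by
  have h1 : (starRingEnd ℂ) u * u = 1 := by rw [Complex.conj_mul', hu]; simp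
  have h2 : u * (starRingEnd ℂ) u = 1 := by rw [mul_comm]; exact h1
  simp only [rotatedBlock, matH, matZ, conjTranspose_add, conjTranspose_smul,
    conjTranspose_conjTranspose, Matrix.add_mul, Matrix.mul_add, Matrix.smul_mul, Matrix.mul_smul,
    smul_add, smul_smul, conjTranspose_mul, ← starRingEnd_apply, Complex.conj_conj, h1, h2, one_smul,
    map_pow, ← pow_two]
  abel

lemma norm_sq_rotatedBlock {m : ℕ} (C : Matrix (Fin m) (Fin 2) ℂ)
    (D : Matrix (Fin 2) (Fin m) ℂ) (U : Matrix (Fin 2) (Fin 2) ℂ) (h : Fin 2 → ℝ)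
    (hH : Uᴴ * matH C D * U = diagonal fun i => (h i : ℂ)) (ζ : Matrix (Fin 2) (Fin 2) ℂ)
    (hζ : ζ = Uᴴ * matZ C D * U) {u : ℂ} (hu : ‖u‖ = 1) (g : EuclideanSpace ℂ (Fin 2)) :
    ‖toEuclideanLin (rotatedBlock C D u) (toEuclideanLin U g)‖ ^ 2
      = pencilMean h ζ (u ^ 2) * (‖g 0‖ ^ 2 + ‖g 1‖ ^ 2)
        + ((h 0 - h 1) / 2 + (u ^ 2 * (ζ 0 0 - ζ 1 1)).re) * (‖g 0‖ ^ 2 - ‖g 1‖ ^ 2)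
        + 2 * ((u ^ 2 * ζ 0 1 + (starRingEnd ℂ) (u ^ 2 * ζ 1 0))
            * ((starRingEnd ℂ) (g 0) * g 1)).re := by
  have h1 : toEuclideanLin (rotatedBlock C D u) (toEuclideanLin U g)
      = toEuclideanLin (rotatedBlock C D u * U) g := by
    simp [toLpLin_apply]
  have h2 : (rotatedBlock C D u * U)ᴴ * (rotatedBlock C D u * U)
      = (diagonal fun i => (h i : ℂ)) + u ^ 2 • ζ + (u ^ 2 • ζ)ᴴ := by
    rw [conjTranspose_mul, Matrix.mul_assoc, ← Matrix.mul_assoc (rotatedBlock C D u)ᴴ,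
      conjTranspose_mul_rotatedBlock C D hu, ← hH, hζ]
    simp only [Matrix.add_mul, Matrix.mul_add, conjTranspose_smul, conjTranspose_mul,
      conjTranspose_conjTranspose, Matrix.smul_mul, Matrix.mul_smul, Matrix.mul_assoc]
  have h3 := norm_sq_toEuclideanLin (rotatedBlock C D u * U) g
  rw [h2] at h3
  have h4 := congrArg Complex.re h3
  rw [h1, ← ofReal_re (‖_‖ ^ 2), h4]
  simp only [pencilMean, Complex.sq_norm, normSq_apply]
  generalize u ^ 2 = v
  simp [dotProduct, mulVec, Fin.sum_univ_two, Matrix.add_apply, diagonal_apply]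
  ring

lemma exists_norm_eq_conj_mul {a b : ℝ} (ha : 0 ≤ a) (hb : 0 ≤ b) (κ : ℂ) :
    ∃ x y : ℂ, ‖x‖ = a ∧ ‖y‖ = b ∧ (κ * ((starRingEnd ℂ) x * y)).re = ‖κ‖ * (a * b) := by
  obtain ⟨e, he, hκ⟩ : ∃ e : ℂ, ‖e‖ = 1 ∧ κ * e = ‖κ‖ := by
    by_cases h0 : κ = 0
    · exact ⟨1, by simp, by simp [h0]⟩
    · have hn : (‖κ‖ : ℂ) ≠ 0 := by simpa using h0
      refine ⟨(starRingEnd ℂ) κ / ‖κ‖, ?_, ?_⟩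
      · rw [norm_div, RCLike.norm_conj, norm_real, norm_norm, div_self (by simpa using h0)]
      · rw [← mul_div_assoc, Complex.mul_conj', pow_two, mul_div_assoc, div_self hn, mul_one]
  refine ⟨a, b * e, by simp [abs_of_nonneg ha], by simp [he, abs_of_nonneg hb], ?_⟩
  rw [conj_ofReal, show κ * ((a : ℂ) * (b * e)) = (a * b) * (κ * e) by ring, hκ]
  norm_cast
  ring

lemma norm_sq_rotatedBlock_le {m : ℕ} (C : Matrix (Fin m) (Fin 2) ℂ)
    (D : Matrix (Fin 2) (Fin m) ℂ) (U : Matrix (Fin 2) (Fin 2) ℂ)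
    (hU : U ∈ unitaryGroup (Fin 2) ℂ) (h : Fin 2 → ℝ)
    (hH : Uᴴ * matH C D * U = diagonal fun i => (h i : ℂ)) (ζ : Matrix (Fin 2) (Fin 2) ℂ)
    (hζ : ζ = Uᴴ * matZ C D * U) {u : ℂ} (hu : ‖u‖ = 1)
    (g : EuclideanSpace ℂ (Fin 2)) (hg : ‖g‖ = 1) :
    ‖toEuclideanLin (rotatedBlock C D u) g‖ ^ 2
      ≤ pencilMean h ζ (u ^ 2) + √(pencilDisc h ζ (u ^ 2)) := by
  obtain ⟨g, rfl⟩ : ∃ g', g = toEuclideanLin U g' := by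
    refine ⟨toEuclideanLin Uᴴ g, ?_⟩
    have h1 : U * Uᴴ = 1 := mem_unitaryGroup_iff.mp hU
    rw [toLpLin_apply, toLpLin_apply, mulVec_mulVec, h1, one_mulVec]
  rw [norm_toEuclideanLin_unitary hU] at hg
  have hg2 : ‖g 0‖ ^ 2 + ‖g 1‖ ^ 2 = 1 := by
    rw [← Fin.sum_univ_two (fun i => ‖g i‖ ^ 2), ← EuclideanSpace.norm_sq_eq, hg, one_pow]
  rw [norm_sq_rotatedBlock C D U h hH ζ hζ hu, hg2, pencilDisc]
  set κ := u ^ 2 * ζ 0 1 + (starRingEnd ℂ) (u ^ 2 * ζ 1 0)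
  have h1 : (κ * ((starRingEnd ℂ) (g 0) * g 1)).re ≤ ‖κ‖ * (‖g 0‖ * ‖g 1‖) := by
    refine (Complex.re_le_norm _).trans_eq ?_
    rw [norm_mul, norm_mul, RCLike.norm_conj]
  have h2 := mul_sq_sub_sq_add_le (p := (h 0 - h 1) / 2 + (u ^ 2 * (ζ 0 0 - ζ 1 1)).re)
    (q := ‖κ‖) hg2
  linarith

lemma exists_norm_sq_rotatedBlock_eq_add {m : ℕ} (C : Matrix (Fin m) (Fin 2) ℂ)
    (D : Matrix (Fin 2) (Fin m) ℂ) (U : Matrix (Fin 2) (Fin 2) ℂ)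
    (hU : U ∈ unitaryGroup (Fin 2) ℂ) (h : Fin 2 → ℝ)
    (hH : Uᴴ * matH C D * U = diagonal fun i => (h i : ℂ)) (ζ : Matrix (Fin 2) (Fin 2) ℂ)
    (hζ : ζ = Uᴴ * matZ C D * U) {u : ℂ} (hu : ‖u‖ = 1) :
    ∃ g : EuclideanSpace ℂ (Fin 2), ‖g‖ = 1 ∧
    ‖toEuclideanLin (rotatedBlock C D u) g‖ ^ 2
      = pencilMean h ζ (u ^ 2) + √(pencilDisc h ζ (u ^ 2)) := by
  set κ := u ^ 2 * ζ 0 1 + (starRingEnd ℂ) (u ^ 2 * ζ 1 0) with hκ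
  obtain ⟨a, b, ha, hb, hab, heq⟩ := exists_mul_sq_sub_sq_add_eq
    ((h 0 - h 1) / 2 + (u ^ 2 * (ζ 0 0 - ζ 1 1)).re) (norm_nonneg κ)
  obtain ⟨x, y, hx, hy, hxy⟩ := exists_norm_eq_conj_mul ha hb κ
  have hg2 : ‖x‖ ^ 2 + ‖y‖ ^ 2 = 1 := by rw [hx, hy, hab]
  refine ⟨toEuclideanLin U !₂[x, y], ?_, ?_⟩
  · rw [norm_toEuclideanLin_unitary hU, ← sq_eq_sq₀ (norm_nonneg _) zero_le_one,
      EuclideanSpace.norm_sq_eq]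
    simpa using hg2
  · rw [norm_sq_rotatedBlock C D U h hH ζ hζ hu, pencilDisc]
    simp only [cons_val_zero, cons_val_one, ← hκ, hg2, hxy]
    rw [← heq, hx, hy]
    ring

/-- The smaller eigenvalue, mean minus root, belongs to a Gram matrix and so is nonnegative. The
sign flips in `-(…)` and in `-y` turn the maximiser of the traceless part into its minimiser. -/
lemma sqrt_pencilDisc_le_pencilMean {m : ℕ} (C : Matrix (Fin m) (Fin 2) ℂ)
    (D : Matrix (Fin 2) (Fin m) ℂ) (U : Matrix (Fin 2) (Fin 2) ℂ) (h : Fin 2 → ℝ)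
    (hH : Uᴴ * matH C D * U = diagonal fun i => (h i : ℂ)) (ζ : Matrix (Fin 2) (Fin 2) ℂ)
    (hζ : ζ = Uᴴ * matZ C D * U) {u : ℂ} (hu : ‖u‖ = 1) :
    √(pencilDisc h ζ (u ^ 2)) ≤ pencilMean h ζ (u ^ 2) := by
  set κ := u ^ 2 * ζ 0 1 + (starRingEnd ℂ) (u ^ 2 * ζ 1 0) with hκ
  obtain ⟨a, b, ha, hb, hab, heq⟩ := exists_mul_sq_sub_sq_add_eq
    (-((h 0 - h 1) / 2 + (u ^ 2 * (ζ 0 0 - ζ 1 1)).re)) (norm_nonneg κ)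
  obtain ⟨x, y, hx, hy, hxy⟩ := exists_norm_eq_conj_mul ha hb κ
  have hg2 : ‖x‖ ^ 2 + ‖y‖ ^ 2 = 1 := by rw [hx, hy, hab]
  have h1 := norm_sq_rotatedBlock C D U h hH ζ hζ hu !₂[x, -y]
  simp only [cons_val_zero, cons_val_one, ← hκ, norm_neg, hg2, mul_neg, neg_re, hxy] at h1
  have h2 := sq_nonneg ‖toEuclideanLin (rotatedBlock C D u) (toEuclideanLin U !₂[x, -y])‖
  rw [h1, hx, hy] at h2
  rw [pencilDisc, ← hκ]
  rw [neg_sq] at heq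
  linarith

/-- By `‖f‖² + ‖g‖² = 1`, only `α - β` survives the recentring; under the real part the `D` term may
be conjugated, which merges both off-diagonal terms. -/
lemma re_mul_sub_center {m : ℕ} (C : Matrix (Fin m) (Fin 2) ℂ)
    (D : Matrix (Fin 2) (Fin m) ℂ)
    (u α β : ℂ) (f : EuclideanSpace ℂ (Fin m)) (g : EuclideanSpace ℂ (Fin 2))
    (hfg : ‖f‖ ^ 2 + ‖g‖ ^ 2 = 1) :
    (u * (α * (‖f‖ ^ 2 : ℝ) + β * (‖g‖ ^ 2 : ℝ) + inner ℂ f (toEuclideanLin C g)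
          + inner ℂ g (toEuclideanLin D f) - (α + β) / 2)).re
      = (u * ((α - β) / 2)).re * (‖f‖ ^ 2 - ‖g‖ ^ 2)
        + (inner ℂ f (toEuclideanLin (rotatedBlock C D u) g)).re := by
  have h1 : (inner ℂ f (toEuclideanLin (rotatedBlock C D u) g))
      = u * inner ℂ f (toEuclideanLin C g)
        + (starRingEnd ℂ) (u * inner ℂ g (toEuclideanLin D f)) := by
    rw [rotatedBlock, map_add, map_smul, map_smul, LinearMap.add_apply, LinearMap.smul_apply,
      LinearMap.smul_apply, inner_add_right, inner_smul_right, inner_smul_right,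
      toEuclideanLin_conjTranspose_eq_adjoint, LinearMap.adjoint_inner_right, map_mul,
      inner_conj_symm]
  have h2 : u * (α * (‖f‖ ^ 2 : ℝ) + β * (‖g‖ ^ 2 : ℝ) + inner ℂ f (toEuclideanLin C g)
          + inner ℂ g (toEuclideanLin D f) - (α + β) / 2)
      = ((‖f‖ ^ 2 - ‖g‖ ^ 2 : ℝ) : ℂ) * (u * ((α - β) / 2)) + u * inner ℂ f (toEuclideanLin C g)
        + u * inner ℂ g (toEuclideanLin D f) := by
    have h3 : ((‖f‖ ^ 2 + ‖g‖ ^ 2 : ℝ) : ℂ) = 1 := by rw [hfg]; simp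
    push_cast at h3 ⊢
    linear_combination (u * (α + β) / 2) * h3
  rw [h2, h1]
  simp only [add_re, re_ofReal_mul, conj_re]
  ring

/-- The support function of the numerical range of a block matrix with scalar diagonal blocks. -/
theorem isSupport_numericalRange {m : ℕ} (hm : 1 ≤ m) (α β : ℂ) (C : Matrix (Fin m) (Fin 2) ℂ)
    (D : Matrix (Fin 2) (Fin m) ℂ) (U : Matrix (Fin 2) (Fin 2) ℂ)
    (hU : U ∈ unitaryGroup (Fin 2) ℂ) (h : Fin 2 → ℝ)
    (hH : Uᴴ * matH C D * U = diagonal fun i => (h i : ℂ)) (ζ : Matrix (Fin 2) (Fin 2) ℂ)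
    (hζ : ζ = Uᴴ * matZ C D * U) :
    IsSupport ((α + β) / 2) (numericalRange (scalarDiagBlock α β C D)) fun u =>
      √((u * ((α - β) / 2)).re ^ 2
        + (pencilMean h ζ (u ^ 2) + √(pencilDisc h ζ (u ^ 2))) / 4) := by
  intro u hu
  set p := (u * ((α - β) / 2)).re with hp
  set Λ := pencilMean h ζ (u ^ 2) + √(pencilDisc h ζ (u ^ 2)) with hΛ
  set N := toEuclideanLin (rotatedBlock C D u) with hN
  obtain ⟨g₀, hg₀, hg₀Λ⟩ := exists_norm_sq_rotatedBlock_eq_add C D U hU h hH ζ hζ hu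
  rw [← hΛ, ← hN] at hg₀Λ
  have hΛ0 : 0 ≤ Λ := hg₀Λ ▸ sq_nonneg _
  have hΛ4 : Λ / 4 = (√Λ / 2) ^ 2 := by rw [div_pow, Real.sq_sqrt hΛ0]; norm_num
  have hNg₀ : ‖N g₀‖ = √Λ := by rw [← hg₀Λ, Real.sqrt_sq (norm_nonneg _)]
  change IsGreatest _ (√(p ^ 2 + Λ / 4))
  rw [hΛ4]
  constructor
  -- Maximise in stages: `g₀` is a top singular vector of `N`, `f₀` is aligned with `N g₀`, and `a`,
  -- `b` are the best weights.
  · obtain ⟨a, b, ha, hb, hab, heq⟩ := exists_mul_sq_sub_sq_add_eq p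
      (q := √Λ / 2) (by positivity)
    obtain ⟨f₀, hf₀, hf₀N⟩ : ∃ f : EuclideanSpace ℂ (Fin m), ‖f‖ = 1 ∧
        inner ℂ f (N g₀) = (√Λ : ℂ) := by
      by_cases h0 : N g₀ = 0
      -- Any unit vector does here; one exists because `1 ≤ m`.
      · refine ⟨EuclideanSpace.single ⟨0, hm⟩ 1, by simp, ?_⟩
        rw [← hNg₀, h0]; simp
      · have hn : ‖N g₀‖ ≠ 0 := norm_ne_zero_iff.mpr h0
        refine ⟨((‖N g₀‖⁻¹ : ℝ) : ℂ) • N g₀, ?_, ?_⟩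
        · rw [norm_smul, norm_real, norm_inv, norm_norm, inv_mul_cancel₀ hn]
        · rw [inner_smul_left, conj_ofReal, inner_self_eq_norm_sq_to_K, ← hNg₀]
          have : (‖N g₀‖ : ℂ) ≠ 0 := by exact_mod_cast hn
          push_cast
          field_simp
          rfl
    have hfa : ‖(a : ℂ) • f₀‖ = a := by rw [norm_smul, hf₀, norm_real, Real.norm_of_nonneg ha, mul_one]
    have hgb : ‖(b : ℂ) • g₀‖ = b := by rw [norm_smul, hg₀, norm_real, Real.norm_of_nonneg hb, mul_one]
    have hfg : ‖(a : ℂ) • f₀‖ ^ 2 + ‖(b : ℂ) • g₀‖ ^ 2 = 1 := by rw [hfa, hgb, hab]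
    refine ⟨_, (mem_numericalRange_scalarDiagBlock α β C D _).mpr ⟨_, _, hfg, rfl⟩, ?_⟩
    simp only
    rw [re_mul_sub_center C D u α β _ _ hfg, hfa, hgb, ← heq, ← hN, map_smul, inner_smul_left,
      inner_smul_right, hf₀N, conj_ofReal, ← hp]
    norm_cast
    ring
  · rintro _ ⟨w, hw, rfl⟩
    obtain ⟨f, g, hfg, rfl⟩ := (mem_numericalRange_scalarDiagBlock α β C D _).mp hw
    simp only
    rw [re_mul_sub_center C D u α β _ _ hfg]
    refine le_trans ?_ (mul_sq_sub_sq_add_le (p := p) (q := √Λ / 2) hfg)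
    have h1 : ‖N g‖ ≤ √Λ * ‖g‖ := by
      by_cases h0 : g = 0
      · simp [h0]
      · have hn : ‖g‖ ≠ 0 := norm_ne_zero_iff.mpr h0
        have hn1 : ‖((‖g‖⁻¹ : ℝ) : ℂ) • g‖ = 1 := by
          rw [norm_smul, norm_real, norm_inv, norm_norm, inv_mul_cancel₀ hn]
        have := norm_sq_rotatedBlock_le C D U hU h hH ζ hζ hu _ hn1
        rw [← hΛ, ← hN, map_smul, norm_smul, norm_real, norm_inv, norm_norm] at this
        have := Real.le_sqrt_of_sq_le this
        rwa [inv_mul_le_iff₀ (by positivity), mul_comm] at this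
    have h2 : (inner ℂ f (N g)).re ≤ ‖f‖ * ‖N g‖ :=
      (Complex.re_le_norm _).trans (norm_inner_le_norm _ _)
    have h3 : ‖f‖ * ‖N g‖ ≤ ‖f‖ * (√Λ * ‖g‖) := mul_le_mul_of_nonneg_left h1 (norm_nonneg _)
    rw [← hp, ← hN]
    linarith

/-! ### When the discriminant is the square of a trigonometric polynomial -/

/-- The discriminant of the pencil of a traceless matrix with diagonal entry `ω` and off-diagonal
entries `b`, `c`, relative to `diag(η, -η)`, is the square of a trigonometric polynomial
`X + Re (v Y)`. -/
def DiscIsSquare (η : ℝ) (ω b c : ℂ) : Prop :=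
  ∃ (X : ℝ) (Y : ℂ), η ^ 2 + ‖b‖ ^ 2 + ‖c‖ ^ 2 + 2 * ‖ω‖ ^ 2 = X ^ 2 + ‖Y‖ ^ 2 / 2 ∧
    2 * (η * ω) = X * Y ∧ 4 * (ω ^ 2 + b * c) = Y ^ 2

lemma norm_sq_of_sq_eq {x y : ℂ} {r : ℝ} (hr : 0 ≤ r) (h : x ^ 2 = r * y ^ 2) :
    ‖x‖ ^ 2 = r * ‖y‖ ^ 2 := by
  rw [← norm_pow, h, norm_mul, norm_pow, norm_real, Real.norm_of_nonneg hr]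

lemma norm_mul_le_of_add_sq_nonneg (b c : ℂ) : 2 * ‖b * c‖ ≤ ‖b‖ ^ 2 + ‖c‖ ^ 2 := by
  rw [norm_mul]; nlinarith [sq_nonneg (‖b‖ - ‖c‖)]

/-- Equality case of Schur's inequality: the right side of the norm identity is the sum of the
squared moduli of the eigenvalues of `[[ω, b], [c, -ω]]`, the left its squared Frobenius norm. -/
lemma traceless_normal_iff (ω b c : ℂ) :
    (‖b‖ = ‖c‖ ∧ ω * (starRingEnd ℂ) c = (starRingEnd ℂ) ω * b) ↔
      ‖b‖ ^ 2 + ‖c‖ ^ 2 + 2 * ‖ω‖ ^ 2 = 2 * ‖ω ^ 2 + b * c‖ := by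
  constructor
  · rintro ⟨hbc, hω⟩
    by_cases hc : c = 0
    · have hb : b = 0 := by rw [hc, norm_zero] at hbc; exact norm_eq_zero.mp hbc
      simp [hb, hc]
    · have hcn : 0 < ‖c‖ := norm_pos_iff.mpr hc
      have h1 : (ω ^ 2 + b * c) * (starRingEnd ℂ) c = b * ((‖ω‖ ^ 2 + ‖c‖ ^ 2 : ℝ) : ℂ) := by
        push_cast
        rw [← Complex.mul_conj', ← Complex.mul_conj']
        linear_combination ω * hω
      have h2 := congrArg norm h1
      rw [norm_mul, norm_mul, RCLike.norm_conj, hbc, norm_real,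
        Real.norm_of_nonneg (by positivity), mul_comm] at h2
      have h3 := mul_left_cancel₀ hcn.ne' h2
      rw [h3, hbc]; ring
  · intro h
    have h1 : ‖ω ^ 2 + b * c‖ ≤ ‖ω‖ ^ 2 + ‖b * c‖ := by
      rw [← norm_pow]; exact norm_add_le _ _
    have h2 : (‖b‖ - ‖c‖) ^ 2 ≤ 0 := by
      rw [norm_mul] at h1
      nlinarith
    have hbc : ‖b‖ = ‖c‖ := by
      have := pow_eq_zero_iff (two_ne_zero) |>.mp (le_antisymm h2 (sq_nonneg _))
      linarith
    refine ⟨hbc, ?_⟩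
    have h3 : ‖ω ^ 2 + b * c‖ = ‖ω‖ ^ 2 + ‖b‖ ^ 2 := by rw [hbc] at h ⊢; linarith
    have h4 : ‖ω ^ 2 + b * c‖ ^ 2 = (‖ω‖ ^ 2 + ‖b‖ ^ 2) * (‖ω‖ ^ 2 + ‖b‖ ^ 2) := by rw [h3]; ring
    have h5 : ‖b‖ ^ 2 = ‖c‖ ^ 2 := by rw [hbc]
    -- From `‖ω c̄ - ω̄ b‖² + ‖ω² + b c‖² = (‖ω‖² + ‖b‖²)(‖ω‖² + ‖c‖²)`.
    have h6 : ‖ω * (starRingEnd ℂ) c - (starRingEnd ℂ) ω * b‖ ^ 2 = 0 := by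
      simp only [Complex.sq_norm, normSq_apply] at h4 h5 ⊢
      simp only [mul_re, mul_im, conj_re, conj_im, sub_re, sub_im, add_re, add_im, pow_two] at h4 ⊢
      linear_combination -h4 - (ω.re * ω.re + ω.im * ω.im + b.re * b.re + b.im * b.im) * h5
    exact sub_eq_zero.mp (norm_eq_zero.mp (pow_eq_zero_iff two_ne_zero |>.mp h6))

lemma discIsSquare_of_zero {η : ℝ} {ω b c : ℂ} (h0 : ω ^ 2 + b * c = 0) (hω : η * ω = 0) :
    DiscIsSquare η ω b c := by
  refine ⟨√(η ^ 2 + ‖b‖ ^ 2 + ‖c‖ ^ 2 + 2 * ‖ω‖ ^ 2), 0, ?_, ?_, ?_⟩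
  · rw [Real.sq_sqrt (by positivity)]; simp
  · rw [hω]; simp
  · rw [h0]; simp

lemma discIsSquare_of_diagonal (η : ℝ) (ω : ℂ) : DiscIsSquare η ω 0 0 :=
  ⟨η, 2 * ω, by simp; ring, by ring, by ring⟩

lemma discIsSquare_of_normal {ω b c d : ℂ} (hd : d ^ 2 = ω ^ 2 + b * c)
    (h : ‖b‖ ^ 2 + ‖c‖ ^ 2 + 2 * ‖ω‖ ^ 2 = 2 * ‖ω ^ 2 + b * c‖) : DiscIsSquare 0 ω b c := by
  refine ⟨0, 2 * d, ?_, by simp, by rw [mul_pow, hd]; norm_num⟩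
  rw [← hd, norm_pow] at h
  rw [norm_mul, mul_pow, RCLike.norm_ofNat]
  linarith

lemma discIsSquare_of_eq {η : ℝ} {ω b c d : ℂ} (hd : d ^ 2 = ω ^ 2 + b * c)
    (h : -((η : ℂ) ^ 2 * (b * c)) = (((‖b‖ + ‖c‖) ^ 2 : ℝ) : ℂ) * d ^ 2) (hd0 : d ≠ 0) :
    DiscIsSquare η ω b c := by
  by_cases hS : ‖b‖ + ‖c‖ = 0
  · have hb : b = 0 := norm_eq_zero.mp (by linarith [norm_nonneg b, norm_nonneg c])
    have hc : c = 0 := norm_eq_zero.mp (by linarith [norm_nonneg b, norm_nonneg c])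
    rw [hb, hc]
    exact discIsSquare_of_diagonal η ω
  · have hη : η ≠ 0 := by
      rintro rfl
      have hS' : (((‖b‖ + ‖c‖) ^ 2 : ℝ) : ℂ) ≠ 0 := by exact_mod_cast pow_ne_zero 2 hS
      refine mul_ne_zero hS' (pow_ne_zero 2 hd0) ?_
      rw [← h]; simp
    have hηc : (η : ℂ) ≠ 0 := by exact_mod_cast hη
    -- The hypothesis makes `b c` and `ω²` real multiples of `d²`, namely `-r` and `1 + r`. Then `Y²
    -- = 4 d²` and `X Y = 2 η ω` suggest `Y = 2 ω / √(1 + r)` and `X = η √(1 + r)`.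
    set r : ℝ := (‖b‖ + ‖c‖) ^ 2 / η ^ 2 with hr
    have hr0 : 0 ≤ r := by positivity
    have hrη : r * η ^ 2 = (‖b‖ + ‖c‖) ^ 2 := by rw [hr]; field_simp
    have hbc : b * c = -(r : ℂ) * d ^ 2 := by
      have : (η : ℂ) ^ 2 * (b * c) = (η : ℂ) ^ 2 * (-(r : ℂ) * d ^ 2) := by
        rw [← hrη] at h
        push_cast at h
        linear_combination -h
      exact mul_left_cancel₀ (pow_ne_zero 2 hηc) this
    have hω : ω ^ 2 = ((1 + r : ℝ) : ℂ) * d ^ 2 := by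
      push_cast
      linear_combination -hd - hbc
    have hωn := norm_sq_of_sq_eq (by positivity) hω
    have hbcn : ‖b‖ * ‖c‖ = r * ‖d‖ ^ 2 := by
      rw [← norm_mul, hbc, norm_mul, norm_neg, norm_real, Real.norm_of_nonneg hr0, norm_pow]
    set k : ℝ := √(1 + r) with hk
    have hk0 : 0 < k := Real.sqrt_pos.mpr (by positivity)
    have hkc : (k : ℂ) ≠ 0 := by exact_mod_cast hk0.ne'
    have hk2 : k ^ 2 = 1 + r := Real.sq_sqrt (by positivity)
    have hkd : ω ^ 2 = (k : ℂ) ^ 2 * d ^ 2 := by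
      rw [hω, ← hk2]; push_cast; ring
    refine ⟨η * k, 2 * ω / k, ?_, ?_, ?_⟩
    · rw [norm_div, norm_mul, norm_real, Real.norm_of_nonneg hk0.le, RCLike.norm_ofNat, div_pow,
        mul_pow, mul_pow, hωn, hk2]
      have : (1 + r) ≠ 0 := by positivity
      field_simp
      linear_combination -hrη - 2 * hbcn
    · push_cast; field_simp
    · rw [← hd, div_pow, mul_pow, hkd]
      field_simp
      norm_num

/-- Squaring `X Y = 2 η ω` and using `Y² = 4 d²` gives `η² b c = (η² - X²) d²`. For `η = 0` this
forces `X = 0`, hence the normality identity. For `η ≠ 0` it makes `b c` and `ω²` real multiples of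
`d²`, and the remaining equation fixes the sign and then the size of the ratio. -/
lemma DiscIsSquare.eq_or_normal {η : ℝ} {ω b c d : ℂ} (hd : d ^ 2 = ω ^ 2 + b * c) (hd0 : d ≠ 0)
    (h : DiscIsSquare η ω b c) :
    (η = 0 ∧ ‖b‖ ^ 2 + ‖c‖ ^ 2 + 2 * ‖ω‖ ^ 2 = 2 * ‖ω ^ 2 + b * c‖) ∨
      -((η : ℂ) ^ 2 * (b * c)) = (((‖b‖ + ‖c‖) ^ 2 : ℝ) : ℂ) * d ^ 2 := by
  obtain ⟨X, Y, h1, h2, h3⟩ := h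
  have hYd : Y ^ 2 = ((4 : ℝ) : ℂ) * d ^ 2 := by rw [← h3, hd]; norm_num
  have hYn := norm_sq_of_sq_eq (by norm_num) hYd
  have hD : 0 < ‖d‖ ^ 2 := by have := norm_pos_iff.mpr hd0; positivity
  rw [hYn] at h1
  have hX : (η : ℂ) ^ 2 * (b * c) = ((η ^ 2 - X ^ 2 : ℝ) : ℂ) * d ^ 2 := by
    have h4 : (X : ℂ) ^ 2 * Y ^ 2 = 4 * ((η : ℂ) ^ 2 * ω ^ 2) := by
      rw [← mul_pow, ← h2]; ring
    rw [hYd] at h4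
    push_cast at h4 ⊢
    linear_combination (1 / 4 : ℂ) * h4 - (η : ℂ) ^ 2 * hd
  by_cases hη : η = 0
  · left
    refine ⟨hη, ?_⟩
    have hX0 : X ^ 2 = 0 := by
      rw [hη] at hX
      have : ((X ^ 2 : ℝ) : ℂ) * d ^ 2 = 0 := by push_cast at hX ⊢; linear_combination hX
      exact_mod_cast (mul_eq_zero.mp this).resolve_right (pow_ne_zero 2 hd0)
    rw [← hd, norm_pow]
    rw [hX0, hη] at h1
    linarith
  · right
    have hηc : (η : ℂ) ≠ 0 := by exact_mod_cast hη
    set r : ℝ := (η ^ 2 - X ^ 2) / η ^ 2 with hr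
    have hη2 : 0 < η ^ 2 := by positivity
    have hrη : r * η ^ 2 = η ^ 2 - X ^ 2 := by rw [hr]; field_simp
    have hbc : b * c = (r : ℂ) * d ^ 2 := by
      have : (η : ℂ) ^ 2 * (b * c) = (η : ℂ) ^ 2 * ((r : ℂ) * d ^ 2) := by
        rw [hX, ← hrη]; push_cast; ring
      exact mul_left_cancel₀ (pow_ne_zero 2 hηc) this
    have hω : ω ^ 2 = ((1 - r : ℝ) : ℂ) * d ^ 2 := by
      push_cast
      linear_combination -hd - hbc
    have hbcn : ‖b * c‖ = |r| * ‖d‖ ^ 2 := by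
      rw [hbc, norm_mul, norm_real, Real.norm_eq_abs, norm_pow]
    have hωn : ‖ω‖ ^ 2 = |1 - r| * ‖d‖ ^ 2 := by
      rw [← norm_pow, hω, norm_mul, norm_real, Real.norm_eq_abs, norm_pow]
    have hle := norm_mul_le_of_add_sq_nonneg b c
    -- If `r > 0`, then `‖b‖² + ‖c‖² ≥ 2 |r| ‖d‖²` and `|r| + |1 - r| ≥ 1` make the left side of
    -- `h1` too large by at least `r η²`.
    have hr0 : r ≤ 0 := by
      by_contra! hpos
      have h5 : 1 ≤ |r| + |1 - r| := by
        have := abs_add_le r (1 - r)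
        rwa [add_sub_cancel, abs_one] at this
      have h6 : 0 < r * η ^ 2 := by positivity
      have h7 := mul_le_mul_of_nonneg_right h5 hD.le
      rw [hbcn] at hle
      rw [hωn] at h1
      linarith
    rw [abs_of_nonpos hr0, norm_mul] at hbcn
    rw [abs_of_nonneg (by linarith)] at hωn
    rw [hωn] at h1
    have h8 : (‖b‖ + ‖c‖) ^ 2 = -(η ^ 2 - X ^ 2) := by linear_combination h1 + 2 * hbcn
    rw [hX, h8]
    push_cast
    ring

lemma DiscIsSquare.mul_eq_zero {η : ℝ} {ω b c : ℂ} (h0 : ω ^ 2 + b * c = 0)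
    (h : DiscIsSquare η ω b c) : η = 0 ∨ b = 0 ∨ c = 0 := by
  obtain ⟨X, Y, -, h2, h3⟩ := h
  have hY : Y = 0 := by
    rw [h0, mul_zero] at h3
    exact pow_eq_zero_iff two_ne_zero |>.mp h3.symm
  rw [hY, mul_zero] at h2
  have h4 : (η : ℂ) = 0 ∨ ω = 0 := by simpa using h2
  rcases h4 with h4 | h4
  · exact Or.inl (by exact_mod_cast h4)
  · rw [h4] at h0
    right
    simpa using h0

/-! ### Translation of the matrix conditions -/

lemma isStarNormal_fin_two_iff (ζ : Matrix (Fin 2) (Fin 2) ℂ) : IsStarNormal ζ ↔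
    ‖ζ 0 1‖ ^ 2 + ‖ζ 1 0‖ ^ 2 + 2 * ‖(ζ 0 0 - ζ 1 1) / 2‖ ^ 2
      = 2 * ‖((ζ 0 0 - ζ 1 1) / 2) ^ 2 + ζ 0 1 * ζ 1 0‖ := by
  rw [← traceless_normal_iff, isStarNormal_iff, commute_iff_eq, ← Matrix.ext_iff]
  simp only [Fin.forall_fin_two, Matrix.mul_apply, Fin.sum_univ_two, star_apply,
    ← starRingEnd_apply]
  rw [← sq_eq_sq₀ (norm_nonneg (ζ 0 1)) (norm_nonneg (ζ 1 0)), ← Complex.ofReal_inj]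
  push_cast
  rw [← Complex.mul_conj', ← Complex.mul_conj', map_div₀, map_sub, map_ofNat]
  constructor
  · rintro ⟨⟨h1, h2⟩, h3, h4⟩
    exact ⟨by linear_combination -h1, by linear_combination (-1 / 2 : ℂ) * h2⟩
  · rintro ⟨h1, h2⟩
    have h3 := congrArg (starRingEnd ℂ) h2
    simp only [map_mul, map_div₀, map_sub, map_ofNat, Complex.conj_conj] at h3
    exact ⟨⟨by linear_combination -h1, by linear_combination -2 * h2⟩,
      by linear_combination -2 * h3, by linear_combination h1⟩

lemma commute_diagonal_fin_two_iff (ζ : Matrix (Fin 2) (Fin 2) ℂ) (h : Fin 2 → ℝ) :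
    Commute ζ (diagonal fun i => (h i : ℂ)) ↔ h 0 = h 1 ∨ (ζ 0 1 = 0 ∧ ζ 1 0 = 0) := by
  rw [commute_iff_eq, ← Matrix.ext_iff]
  simp only [Fin.forall_fin_two, Matrix.mul_diagonal, Matrix.diagonal_mul]
  constructor
  · rintro ⟨⟨-, h1⟩, h2, -⟩
    by_cases h0 : h 0 = h 1
    · exact Or.inl h0
    · right
      have h0' : (h 0 : ℂ) - h 1 ≠ 0 := sub_ne_zero.mpr (by exact_mod_cast h0)
      constructor
      · exact (mul_eq_zero.mp (show ((h 0 : ℂ) - h 1) * ζ 0 1 = 0 by linear_combination -h1)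
          ).resolve_left h0'
      · exact (mul_eq_zero.mp (show ((h 0 : ℂ) - h 1) * ζ 1 0 = 0 by linear_combination h2)
          ).resolve_left h0'
  · rintro (h0 | ⟨h1, h2⟩)
    · rw [h0]; simp [mul_comm]
    · simp [h1, h2, mul_comm]

/-- For `h 0 ≠ h 1` the only eigenvectors of the diagonal matrix are multiples of the basis vectors;
for `h 0 = h 1` any eigenvector of `ζ` serves. -/
lemma shareEigenvector_diagonal_iff (ζ : Matrix (Fin 2) (Fin 2) ℂ) (h : Fin 2 → ℝ) :
    ShareEigenvector ζ (diagonal fun i => (h i : ℂ)) ↔ h 0 = h 1 ∨ ζ 0 1 = 0 ∨ ζ 1 0 = 0 := by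
  constructor
  · rintro ⟨v, s, t, ⟨h1, hv⟩, ⟨h2, -⟩⟩
    rw [Module.End.mem_eigenspace_iff, toLin'_apply] at h1 h2
    have e0 := congrFun h2 0
    have e1 := congrFun h2 1
    have f0 := congrFun h1 0
    have f1 := congrFun h1 1
    simp only [Pi.smul_apply, smul_eq_mul, mulVec, dotProduct,
      Fin.sum_univ_two] at e0 e1 f0 f1
    by_cases v0 : v 0 = 0
    · by_cases v1 : v 1 = 0
      · exact absurd (by ext i; fin_cases i <;> simp [v0, v1]) hv
      · right; left
        rw [v0] at f0
        simpa [v1] using f0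
    · by_cases v1 : v 1 = 0
      · right; right
        rw [v1] at f1
        simpa [v0] using f1
      · left
        have g0 : (h 0 : ℂ) = t := by simpa [diagonal_apply, v0] using e0
        have g1 : (h 1 : ℂ) = t := by simpa [diagonal_apply, v1] using e1
        exact_mod_cast g0.trans g1.symm
  · rintro (h0 | h0 | h0)
    · obtain ⟨s, hs⟩ := Module.End.exists_eigenvalue (toLin' ζ)
      obtain ⟨v, hv⟩ := hs.exists_hasEigenvector
      refine ⟨v, s, h 0, hv, ?_, hv.2⟩
      rw [Module.End.mem_eigenspace_iff, toLin'_apply]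
      ext i
      fin_cases i <;> simp [mulVec_diagonal, h0]
    · refine ⟨![0, 1], ζ 1 1, h 1, ⟨?_, by simp⟩, ⟨?_, by simp⟩⟩ <;>
        rw [Module.End.mem_eigenspace_iff, toLin'_apply] <;> ext i <;>
        fin_cases i <;> simp [mulVec, dotProduct, diagonal_apply, h0]
    · refine ⟨![1, 0], ζ 0 0, h 0, ⟨?_, by simp⟩, ⟨?_, by simp⟩⟩ <;>
        rw [Module.End.mem_eigenspace_iff, toLin'_apply] <;> ext i <;>
        fin_cases i <;> simp [mulVec, dotProduct, diagonal_apply, h0]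

section UnitaryInvariance

variable {k : ℕ} {U X Y : Matrix (Fin k) (Fin k) ℂ}

lemma unitary_conj_conj (hU : U ∈ unitaryGroup (Fin k) ℂ) (X : Matrix (Fin k) (Fin k) ℂ) :
    U * (Uᴴ * X * U) * Uᴴ = X := by
  have h1 : U * Uᴴ = 1 := mem_unitaryGroup_iff.mp hU
  rw [← Matrix.mul_assoc, ← Matrix.mul_assoc, h1, Matrix.one_mul, Matrix.mul_assoc, h1,
    Matrix.mul_one]

lemma conj_mul_conj (hU : U ∈ unitaryGroup (Fin k) ℂ) (X Y : Matrix (Fin k) (Fin k) ℂ) :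
    (Uᴴ * X * U) * (Uᴴ * Y * U) = Uᴴ * (X * Y) * U := by
  have h1 : U * Uᴴ = 1 := mem_unitaryGroup_iff.mp hU
  calc (Uᴴ * X * U) * (Uᴴ * Y * U) = Uᴴ * X * (U * Uᴴ) * Y * U := by simp only [Matrix.mul_assoc]
    _ = _ := by rw [h1, Matrix.mul_one]; simp only [Matrix.mul_assoc]

lemma unitary_conj_injective (hU : U ∈ unitaryGroup (Fin k) ℂ) :
    Function.Injective fun X : Matrix (Fin k) (Fin k) ℂ => Uᴴ * X * U := fun X Y hXY => by
  rw [← unitary_conj_conj hU X, ← unitary_conj_conj hU Y]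
  exact congrArg (fun M => U * M * Uᴴ) hXY

lemma commute_conj_iff (hU : U ∈ unitaryGroup (Fin k) ℂ) :
    Commute (Uᴴ * X * U) (Uᴴ * Y * U) ↔ Commute X Y := by
  rw [commute_iff_eq, commute_iff_eq, conj_mul_conj hU, conj_mul_conj hU]
  exact (unitary_conj_injective hU).eq_iff

lemma isStarNormal_conj_iff (hU : U ∈ unitaryGroup (Fin k) ℂ) :
    IsStarNormal (Uᴴ * X * U) ↔ IsStarNormal X := by
  rw [isStarNormal_iff, isStarNormal_iff, ← commute_conj_iff hU (X := star X)]
  have : star (Uᴴ * X * U) = Uᴴ * star X * U := by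
    simp only [star_eq_conjTranspose, conjTranspose_mul, conjTranspose_conjTranspose,
      Matrix.mul_assoc]
  rw [this]

lemma ShareEigenvector.conj (hU : U ∈ unitaryGroup (Fin k) ℂ) (h : ShareEigenvector X Y) :
    ShareEigenvector (Uᴴ * X * U) (Uᴴ * Y * U) := by
  obtain ⟨v, s, t, ⟨h1, hv⟩, ⟨h2, -⟩⟩ := h
  have hu : U * Uᴴ = 1 := mem_unitaryGroup_iff.mp hU
  rw [Module.End.mem_eigenspace_iff, toLin'_apply] at h1 h2
  have hv' : Uᴴ *ᵥ v ≠ 0 := by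
    intro h0
    apply hv
    rw [← one_mulVec v, ← hu, ← mulVec_mulVec, h0, mulVec_zero]
  have key : ∀ (M : Matrix (Fin k) (Fin k) ℂ) (r : ℂ), M *ᵥ v = r • v →
      (Uᴴ * M * U) *ᵥ (Uᴴ *ᵥ v) = r • (Uᴴ *ᵥ v) := by
    intro M r hM
    rw [mulVec_mulVec, Matrix.mul_assoc, hu, Matrix.mul_one, ← mulVec_mulVec, hM, mulVec_smul]
  refine ⟨Uᴴ *ᵥ v, s, t, ⟨?_, hv'⟩, ⟨?_, hv'⟩⟩ <;>
    rw [Module.End.mem_eigenspace_iff, toLin'_apply]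
  · exact key X s h1
  · exact key Y t h2

lemma shareEigenvector_conj_iff (hU : U ∈ unitaryGroup (Fin k) ℂ) :
    ShareEigenvector (Uᴴ * X * U) (Uᴴ * Y * U) ↔ ShareEigenvector X Y := by
  refine ⟨fun h => ?_, ShareEigenvector.conj hU⟩
  have hU' : Uᴴ ∈ unitaryGroup (Fin k) ℂ := Unitary.star_mem hU
  have := h.conj hU'
  rwa [conjTranspose_conjTranspose, unitary_conj_conj hU, unitary_conj_conj hU] at this

end UnitaryInvariance

lemma sub_sq_of_charpoly_roots {Z : Matrix (Fin 2) (Fin 2) ℂ} {z₁ z₂ : ℂ}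
    (hz : Z.charpoly.roots = {z₁, z₂}) : (z₁ - z₂) ^ 2 = Z.trace ^ 2 - 4 * Z.det := by
  have h1 := Matrix.trace_eq_sum_roots_charpoly Z
  have h2 := Matrix.det_eq_prod_roots_charpoly Z
  rw [hz] at h1 h2
  simp only [Multiset.insert_eq_cons, Multiset.sum_cons, Multiset.sum_singleton,
    Multiset.prod_cons, Multiset.prod_singleton] at h1 h2
  rw [h1, h2]; ring

/-- The three conditions, and the discriminant being a square. -/
theorem discIsSquare_iff {Z H U : Matrix (Fin 2) (Fin 2) ℂ} (hU : U ∈ unitaryGroup (Fin 2) ℂ)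
    (h : Fin 2 → ℝ) (hH : Uᴴ * H * U = diagonal fun i => (h i : ℂ)) (z₁ z₂ : ℂ)
    (hz : Z.charpoly.roots = {z₁, z₂}) (ζ : Matrix (Fin 2) (Fin 2) ℂ) (hζ : ζ = Uᴴ * Z * U) :
    DiscIsSquare ((h 0 - h 1) / 2) ((ζ 0 0 - ζ 1 1) / 2) (ζ 0 1) (ζ 1 0) ↔
      (IsStarNormal Z ∧ Commute Z H) ∨
      (z₁ = z₂ ∧ ShareEigenvector Z H) ∨
      (z₁ ≠ z₂ ∧
        -((h 0 : ℂ) - (h 1 : ℂ)) ^ 2 * (ζ 0 1 * ζ 1 0 / (z₁ - z₂) ^ 2)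
          = (((‖ζ 0 1‖ + ‖ζ 1 0‖) ^ 2 : ℝ) : ℂ)) := by
  have hu : U * Uᴴ = 1 := mem_unitaryGroup_iff.mp hU
  have htr : ζ.trace = Z.trace := by
    rw [hζ, Matrix.trace_mul_comm, ← Matrix.mul_assoc, hu, Matrix.one_mul]
  have hdet : ζ.det = Z.det := by
    have := congrArg det hu
    rw [det_mul, det_one] at this
    rw [hζ, det_mul, det_mul]
    linear_combination Z.det * this
  -- Both sides are a quarter of the discriminant of the characteristic polynomial, a unitary
  -- invariant.
  have hd : ((z₁ - z₂) / 2) ^ 2 = ((ζ 0 0 - ζ 1 1) / 2) ^ 2 + ζ 0 1 * ζ 1 0 := by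
    have := sub_sq_of_charpoly_roots hz
    rw [← htr, ← hdet, trace_fin_two, det_fin_two] at this
    linear_combination (1 / 4 : ℂ) * this
  rw [← isStarNormal_conj_iff hU, ← commute_conj_iff hU, ← shareEigenvector_conj_iff hU, hH, ← hζ,
    isStarNormal_fin_two_iff, commute_diagonal_fin_two_iff, shareEigenvector_diagonal_iff]
  have hη : (h 0 - h 1) / 2 = 0 ↔ h 0 = h 1 := by
    constructor <;> intro h' <;> linarith
  have hiii : z₁ ≠ z₂ → (-((h 0 : ℂ) - (h 1 : ℂ)) ^ 2 * (ζ 0 1 * ζ 1 0 / (z₁ - z₂) ^ 2)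
      = (((‖ζ 0 1‖ + ‖ζ 1 0‖) ^ 2 : ℝ) : ℂ) ↔
      -((((h 0 - h 1) / 2 : ℝ) : ℂ) ^ 2 * (ζ 0 1 * ζ 1 0))
        = (((‖ζ 0 1‖ + ‖ζ 1 0‖) ^ 2 : ℝ) : ℂ) * ((z₁ - z₂) / 2) ^ 2) := by
    intro hne
    have h0 : (z₁ - z₂) ^ 2 ≠ 0 := pow_ne_zero 2 (sub_ne_zero.mpr hne)
    rw [← mul_div_assoc, div_eq_iff h0]
    push_cast
    constructor
    · intro h'; linear_combination (1 / 4 : ℂ) * h'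
    · intro h'; linear_combination 4 * h'
  generalize (ζ 0 0 - ζ 1 1) / 2 = ω at *
  generalize ζ 0 1 = b at *
  generalize ζ 1 0 = c at *
  constructor
  · intro hsq
    by_cases hne : z₁ = z₂
    · right; left
      have h0 : ω ^ 2 + b * c = 0 := by rw [← hd, hne]; simp
      refine ⟨hne, ?_⟩
      rw [← hη]
      exact hsq.mul_eq_zero h0
    · rcases hsq.eq_or_normal hd (div_ne_zero (sub_ne_zero.mpr hne) two_ne_zero) with h' | h'
      · exact Or.inl ⟨h'.2, Or.inl (hη.mp h'.1)⟩
      · exact Or.inr (Or.inr ⟨hne, (hiii hne).mpr h'⟩)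
  · rintro (⟨h1, h2 | ⟨rfl, rfl⟩⟩ | ⟨h1, h2⟩ | ⟨h1, h2⟩)
    · rw [hη.mpr h2]
      exact discIsSquare_of_normal hd h1
    · exact discIsSquare_of_diagonal _ _
    · have h0 : ω ^ 2 + b * c = 0 := by rw [← hd, h1]; simp
      refine discIsSquare_of_zero h0 ?_
      rcases h2 with h2 | rfl | rfl
      · rw [hη.mpr h2]; simp
      · have : ω = 0 := by simpa using h0
        rw [this, mul_zero]
      · have : ω = 0 := by simpa using h0
        rw [this, mul_zero]
    · exact discIsSquare_of_eq hd ((hiii h1).mp h2)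
        (div_ne_zero (sub_ne_zero.mpr h1) two_ne_zero)

/-! ### Trigonometric polynomials -/

lemma infinite_unit_circle : {u : ℂ | ‖u‖ = 1}.Infinite := by
  have h1 : {u : ℂ | ‖u‖ = 1} = Metric.sphere (0 : ℂ) 1 := by ext; simp
  rw [h1]
  refine (isPreconnected_sphere (by simp) (0 : ℂ) 1).infinite_of_nontrivial ?_
  exact ⟨1, by simp, -1, by simp, by norm_num⟩

lemma two_mul_re_eq {u : ℂ} (hu : ‖u‖ = 1) (n : ℕ) (g : ℂ) :
    u ^ n * (2 * ((u ^ n * g).re : ℂ)) = u ^ (2 * n) * g + (starRingEnd ℂ) g := by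
  have h1 : (starRingEnd ℂ) u * u = 1 := by rw [Complex.conj_mul', hu]; simp
  have h2 : ((starRingEnd ℂ) u) ^ n * u ^ n = 1 := by rw [← mul_pow, h1, one_pow]
  rw [show (2 : ℂ) * ((u ^ n * g).re : ℂ) = u ^ n * g + (starRingEnd ℂ) (u ^ n * g) by
    rw [Complex.add_conj]; push_cast; ring, map_mul, map_pow]
  linear_combination (starRingEnd ℂ) g * h2

/-- On the circle `ū = u⁻¹`, so multiplying by `2 u⁴` gives a polynomial in `u` of degree at most 8
with infinitely many roots. -/
lemma trig_coeff_eq_zero {S : Set ℂ} (hS : S.Infinite) (hu : ∀ u ∈ S, ‖u‖ = 1) (r : ℝ) (g₁ g₂ : ℂ)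
    (h : ∀ u ∈ S, r + (u ^ 2 * g₁).re + (u ^ 4 * g₂).re = 0) : r = 0 ∧ g₁ = 0 ∧ g₂ = 0 := by
  obtain ⟨ρ, hρ⟩ : ∃ ρ : ℂ, ρ = 2 * (r : ℂ) := ⟨_, rfl⟩
  set p : Polynomial ℂ := Polynomial.C g₂ * Polynomial.X ^ 8 + Polynomial.C g₁ * Polynomial.X ^ 6
    + Polynomial.C ρ * Polynomial.X ^ 4
    + Polynomial.C ((starRingEnd ℂ) g₁) * Polynomial.X ^ 2
    + Polynomial.C ((starRingEnd ℂ) g₂) with hp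
  have hp0 : p = 0 := by
    refine Polynomial.eq_zero_of_infinite_isRoot p (hS.mono fun u huS => ?_)
    have h1 := two_mul_re_eq (hu u huS) 2 g₁
    have h2 := two_mul_re_eq (hu u huS) 4 g₂
    have h3 : (r : ℂ) + ((u ^ 2 * g₁).re : ℂ) + ((u ^ 4 * g₂).re : ℂ) = 0 := by
      exact_mod_cast h u huS
    change p.eval u = 0
    simp only [hp, Polynomial.eval_add, Polynomial.eval_mul, Polynomial.eval_pow, Polynomial.eval_X,
      Polynomial.eval_C]
    rw [hρ]
    linear_combination 2 * u ^ 4 * h3 - u ^ 2 * h1 - h2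
  have c4 := congrArg (fun q => q.coeff 4) hp0
  have c6 := congrArg (fun q => q.coeff 6) hp0
  have c8 := congrArg (fun q => q.coeff 8) hp0
  simp [hp, Polynomial.coeff_X_pow] at c4 c6 c8
  exact ⟨by simpa [c4] using hρ.symm, c6, c8⟩

lemma sq_add_re_mul {v : ℂ} (hv : ‖v‖ = 1) (x : ℝ) (y : ℂ) :
    (x + (v * y).re) ^ 2 = x ^ 2 + ‖y‖ ^ 2 / 2 + (v * (2 * x * y)).re + (v ^ 2 * (y ^ 2 / 2)).re := by
  have h1 : ‖y‖ ^ 2 = (v * y).re ^ 2 + (v * y).im ^ 2 := by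
    rw [show ‖y‖ ^ 2 = ‖v * y‖ ^ 2 by rw [norm_mul, hv, one_mul], Complex.sq_norm, normSq_apply]
    ring
  rw [h1, show v * (2 * x * y) = ((2 * x : ℝ) : ℂ) * (v * y) by push_cast; ring,
    show v ^ 2 * (y ^ 2 / 2) = ((1 / 2 : ℝ) : ℂ) * ((v * y) * (v * y)) by push_cast; ring,
    re_ofReal_mul, re_ofReal_mul, mul_re (v * y)]
  ring

lemma norm_sq_add_conj {v : ℂ} (hv : ‖v‖ = 1) (b c : ℂ) :
    ‖v * b + (starRingEnd ℂ) (v * c)‖ ^ 2 = ‖b‖ ^ 2 + ‖c‖ ^ 2 + (v ^ 2 * (2 * (b * c))).re := by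
  rw [show ‖b‖ ^ 2 = ‖v * b‖ ^ 2 by rw [norm_mul, hv, one_mul],
    show ‖c‖ ^ 2 = ‖v * c‖ ^ 2 by rw [norm_mul, hv, one_mul],
    show v ^ 2 * (2 * (b * c)) = ((2 : ℝ) : ℂ) * ((v * b) * (v * c)) by push_cast; ring,
    re_ofReal_mul]
  simp only [Complex.sq_norm, normSq_apply, add_re, add_im, conj_re, conj_im, mul_re (v * b)]
  ring

/-- The Fourier coefficients of the discriminant; matching them with those of `(X + Re (v Y))²`
gives the equations of `DiscIsSquare`. -/
lemma pencilDisc_eq (h : Fin 2 → ℝ) (ζ : Matrix (Fin 2) (Fin 2) ℂ) {v : ℂ} (hv : ‖v‖ = 1) :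
    pencilDisc h ζ v = (((h 0 - h 1) / 2) ^ 2 + ‖ζ 0 1‖ ^ 2 + ‖ζ 1 0‖ ^ 2
        + 2 * ‖(ζ 0 0 - ζ 1 1) / 2‖ ^ 2)
      + (v * (4 * (((h 0 - h 1) / 2 : ℝ) * ((ζ 0 0 - ζ 1 1) / 2)))).re
      + (v ^ 2 * (2 * (((ζ 0 0 - ζ 1 1) / 2) ^ 2 + ζ 0 1 * ζ 1 0))).re := by
  rw [pencilDisc, sq_add_re_mul hv, norm_sq_add_conj hv]
  generalize (h 0 - h 1) / 2 = η
  obtain ⟨ω, hω⟩ : ∃ ω, ω = (ζ 0 0 - ζ 1 1) / 2 := ⟨_, rfl⟩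
  rw [← hω, show ζ 0 0 - ζ 1 1 = 2 * ω by rw [hω]; ring, norm_mul, mul_pow, RCLike.norm_ofNat]
  rw [show v * (2 * (η : ℂ) * (2 * ω)) = v * (4 * ((η : ℂ) * ω)) by ring, mul_pow,
    show v ^ 2 * (2 * (ω ^ 2 + ζ 0 1 * ζ 1 0)) = v ^ 2 * (2 ^ 2 * ω ^ 2 / 2)
      + v ^ 2 * (2 * (ζ 0 1 * ζ 1 0)) by ring, add_re]
  ring

lemma four_mul_re_sq {u : ℂ} (hu : ‖u‖ = 1) (δ : ℂ) :
    4 * (u * δ).re ^ 2 = 2 * ‖δ‖ ^ 2 + (u ^ 2 * (2 * δ ^ 2)).re := by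
  have := sq_add_re_mul hu 0 δ
  rw [zero_add] at this
  rw [this, show u ^ 2 * (2 * δ ^ 2) = ((4 : ℝ) : ℂ) * (u ^ 2 * (δ ^ 2 / 2)) by push_cast; ring,
    re_ofReal_mul]
  simp
  ring

/-- The direction in which `Re (u² q)` is least; nonnegativity of `P + Re (u² q)` there means `‖q‖ ≤
P`. -/
lemma exists_sq_mul_eq_neg_norm (q : ℂ) : ∃ u : ℂ, ‖u‖ = 1 ∧ u ^ 2 * q = -(‖q‖ : ℂ) := by
  refine ⟨Complex.exp ((((Real.pi - arg q) / 2 : ℝ) : ℂ) * I), norm_exp_ofReal_mul_I _, ?_⟩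
  have h1 := Complex.norm_mul_exp_arg_mul_I q
  have h2 : Complex.exp ((((Real.pi - arg q) / 2 : ℝ) : ℂ) * I) ^ 2
      * Complex.exp ((arg q : ℂ) * I) = -1 := by
    rw [← Complex.exp_nat_mul, ← Complex.exp_add, ← Complex.exp_pi_mul_I]
    congr 1
    push_cast
    ring
  linear_combination -Complex.exp ((((Real.pi - arg q) / 2 : ℝ) : ℂ) * I) ^ 2 * h1 + ‖q‖ * h2

/-- Every function `√((P + Re (u² q)) / 4)` with `‖q‖ ≤ P` is the support function of an ellipse. -/
lemma exists_ellipse_isSupport (c : ℂ) {P : ℝ} {q : ℂ} (h : ‖q‖ ≤ P) :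
    ∃ E, IsEllipseCenteredAt c E ∧ IsCompact (convexHull ℝ E) ∧ E.Nonempty ∧
      IsSupport c E fun u => √((P + (u ^ 2 * q).re) / 4) := by
  have hq := norm_nonneg q
  have ha : 0 ≤ (P + ‖q‖) / 4 := by linarith
  have hb : 0 ≤ (P - ‖q‖) / 4 := by linarith
  -- The semi-axes solve `a² + b² = P / 2` and `a² - b² = ‖q‖ / 2`; the angle is half of `arg q`
  -- because the direction enters squared.
  refine ⟨ellipse c √((P + ‖q‖) / 4) √((P - ‖q‖) / 4) (arg q / 2),
    ⟨_, _, _, Real.sqrt_nonneg _, Real.sqrt_le_sqrt (by linarith), rfl⟩,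
    isCompact_convexHull_ellipse _ _ _ _, ellipse_nonempty _ _ _ _, ?_⟩
  convert isSupport_ellipse c √((P + ‖q‖) / 4) √((P - ‖q‖) / 4) (arg q / 2) using 2 with u
  rw [Real.sq_sqrt ha, Real.sq_sqrt hb, ← Complex.exp_nat_mul]
  have h1 := Complex.norm_mul_exp_arg_mul_I q
  have h2 : ((2 : ℕ) : ℂ) * (((arg q / 2 : ℝ) : ℂ) * I) = (arg q : ℂ) * I := by push_cast; ring
  rw [h2]
  have h3 : u ^ 2 * (((((P + ‖q‖) / 4 - (P - ‖q‖) / 4) / 2 : ℝ) : ℂ)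
      * Complex.exp ((arg q : ℂ) * I)) = ((1 / 4 : ℝ) : ℂ) * (u ^ 2 * q) := by
    push_cast
    linear_combination (u ^ 2 / 4) * h1
  rw [h3, re_ofReal_mul]
  congr 1
  ring

/-! ### Numerical ranges that are convex hulls of ellipses -/

section

variable {δ : ℂ} {h : Fin 2 → ℝ} {ζ : Matrix (Fin 2) (Fin 2) ℂ} {c : ℂ} {W : Set ℂ}

/-- If the discriminant agrees with squares of trigonometric polynomials at infinitely many points,
then it is a square. -/
lemma discIsSquare_of_infinite {S : Set ℂ} (hS : S.Infinite) (hu : ∀ u ∈ S, ‖u‖ = 1) (X : ℝ)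
    (Y : ℂ) (hXY : ∀ u ∈ S, pencilDisc h ζ (u ^ 2) = (X + (u ^ 2 * Y).re) ^ 2) :
    DiscIsSquare ((h 0 - h 1) / 2) ((ζ 0 0 - ζ 1 1) / 2) (ζ 0 1) (ζ 1 0) := by
  generalize hη : (h 0 - h 1) / 2 = η
  generalize hω : (ζ 0 0 - ζ 1 1) / 2 = ω
  obtain ⟨h0, h1, h2⟩ := trig_coeff_eq_zero hS hu
    (η ^ 2 + ‖ζ 0 1‖ ^ 2 + ‖ζ 1 0‖ ^ 2 + 2 * ‖ω‖ ^ 2 - (X ^ 2 + ‖Y‖ ^ 2 / 2))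
    (4 * (η * ω) - 2 * X * Y) (2 * (ω ^ 2 + ζ 0 1 * ζ 1 0) - Y ^ 2 / 2) (by
      intro u huS
      have hv : ‖u ^ 2‖ = 1 := by rw [norm_pow, hu u huS, one_pow]
      have := hXY u huS
      rw [pencilDisc_eq h ζ hv, sq_add_re_mul hv, hη, hω] at this
      rw [show u ^ 4 = (u ^ 2) ^ 2 by ring, mul_sub, mul_sub, sub_re, sub_re]
      linarith)
  exact ⟨X, Y, by linarith, by linear_combination (1 / 2 : ℂ) * h1, by linear_combination 2 * h2⟩

lemma IsSupport.discIsSquare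
    (hW : IsSupport c W fun u =>
      √((u * δ).re ^ 2 + (pencilMean h ζ (u ^ 2) + √(pencilDisc h ζ (u ^ 2))) / 4))
    (hpos : ∀ u : ℂ, ‖u‖ = 1 → 0 ≤ pencilMean h ζ (u ^ 2))
    (hE : IsConvexHullOfEllipsesCenteredAt c W) :
    DiscIsSquare ((h 0 - h 1) / 2) ((ζ 0 0 - ζ 1 1) / 2) (ζ 0 1) (ζ 1 0) := by
  obtain ⟨F, hfin, -, hell, rfl⟩ := hE
  have hex : ∀ u : ℂ, ‖u‖ = 1 → ∃ E ∈ F, ∃ w ∈ E, (u * (w - c)).re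
      = √((u * δ).re ^ 2 + (pencilMean h ζ (u ^ 2) + √(pencilDisc h ζ (u ^ 2))) / 4) := by
    intro u hu
    obtain ⟨w, ⟨E, hEF, hwE⟩, hw⟩ := hW.exists_of_convexHull hu
    exact ⟨E, hEF, w, hwE, hw⟩
  -- one ellipse is touched in infinitely many directions
  obtain ⟨E, hEF, hinf⟩ : ∃ E ∈ F, {u : ℂ | ‖u‖ = 1 ∧ ∃ w ∈ E, (u * (w - c)).re
      = √((u * δ).re ^ 2 + (pencilMean h ζ (u ^ 2) + √(pencilDisc h ζ (u ^ 2))) / 4)}.Infinite := by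
    by_contra! hcon
    refine infinite_unit_circle ((hfin.biUnion hcon).subset ?_)
    intro u hu
    obtain ⟨E, hEF, hE⟩ := hex u hu
    exact mem_biUnion hEF ⟨hu, hE⟩
  obtain ⟨a, b, φ, -, -, rfl⟩ := hell E hEF
  set P : ℝ := 2 * (a ^ 2 + b ^ 2) with hP
  set q : ℂ := 4 * ((((a ^ 2 - b ^ 2) / 2 : ℝ) : ℂ) * Complex.exp (φ * I) ^ 2) with hq
  -- Four times the squared support function of the ellipse is `P + Re (u² q)`; equating it with
  -- that of `W` and solving for `√disc` gives these `X` and `Y`.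
  refine discIsSquare_of_infinite hinf (fun u hu => hu.1)
    (P - 2 * ‖δ‖ ^ 2 - (h 0 + h 1) / 2) (q - 2 * δ ^ 2 - (ζ 0 0 + ζ 1 1)) ?_
  rintro u ⟨hu, w, hwE, hw⟩
  have hsup := isSupport_ellipse c a b φ u hu
  simp only at hsup
  have hle := hsup.2 ⟨w, hwE, rfl⟩
  have hge : √((a ^ 2 + b ^ 2) / 2
        + (u ^ 2 * (((a ^ 2 - b ^ 2) / 2 : ℝ) * Complex.exp (φ * I) ^ 2)).re)
      ≤ √((u * δ).re ^ 2 + (pencilMean h ζ (u ^ 2) + √(pencilDisc h ζ (u ^ 2))) / 4) := by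
    obtain ⟨x, hx, hxs⟩ := hsup.1
    rw [← hxs]
    exact (hW u hu).2 ⟨x, subset_convexHull ℝ _ ⟨_, hEF, hx⟩, rfl⟩
  simp only at hle
  rw [hw] at hle
  have heq := le_antisymm hle hge
  have hmean := hpos u hu
  have hsq := Real.sqrt_nonneg (pencilDisc h ζ (u ^ 2))
  rw [Real.sqrt_inj (by positivity)
    (by rw [← sq_abs_exp_mul_I_mul u _ hu (norm_exp_ofReal_mul_I φ) a b]; positivity)] at heq
  have h4 := four_mul_re_sq hu δ
  have hqre : (u ^ 2 * q).re
      = 4 * (u ^ 2 * (((a ^ 2 - b ^ 2) / 2 : ℝ) * Complex.exp (φ * I) ^ 2)).re := by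
    rw [hq, ← re_ofReal_mul]
    congr 1
    push_cast
    ring
  have hT : pencilMean h ζ (u ^ 2) = (h 0 + h 1) / 2 + (u ^ 2 * (ζ 0 0 + ζ 1 1)).re := rfl
  rw [← Real.sq_sqrt (pencilDisc_nonneg h ζ (u ^ 2))]
  congr 1
  rw [mul_sub, mul_sub, sub_re, sub_re, hqre]
  linarith

lemma IsSupport.isConvexHullOfEllipses
    (hW : IsSupport c W fun u =>
      √((u * δ).re ^ 2 + (pencilMean h ζ (u ^ 2) + √(pencilDisc h ζ (u ^ 2))) / 4))
    (hc : Convex ℝ W) (hcl : IsClosed W)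
    (hpos : ∀ u : ℂ, ‖u‖ = 1 → √(pencilDisc h ζ (u ^ 2)) ≤ pencilMean h ζ (u ^ 2))
    (hsq : DiscIsSquare ((h 0 - h 1) / 2) ((ζ 0 0 - ζ 1 1) / 2) (ζ 0 1) (ζ 1 0)) :
    IsConvexHullOfEllipsesCenteredAt c W := by
  obtain ⟨X, Y, h0, h1, h2⟩ := hsq
  have hdisc : ∀ u : ℂ, ‖u‖ = 1 → √(pencilDisc h ζ (u ^ 2)) = |X + (u ^ 2 * Y).re| := by
    intro u hu
    have hv : ‖u ^ 2‖ = 1 := by rw [norm_pow, hu, one_pow]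
    rw [← Real.sqrt_sq_eq_abs, pencilDisc_eq h ζ hv, sq_add_re_mul hv, h0]
    congr 4
    · linear_combination (2 * u ^ 2) * h1
    · linear_combination (1 / 2 : ℂ) * h2
  -- the two candidates, and why they are ellipses
  have hval : ∀ (σ : ℝ) (u : ℂ), ‖u‖ = 1 →
      (2 * ‖δ‖ ^ 2 + (h 0 + h 1) / 2 + σ * X)
        + (u ^ 2 * (2 * δ ^ 2 + (ζ 0 0 + ζ 1 1) + σ * Y)).re
      = 4 * (u * δ).re ^ 2 + pencilMean h ζ (u ^ 2) + σ * (X + (u ^ 2 * Y).re) := by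
    intro σ u hu
    rw [four_mul_re_sq hu, pencilMean, mul_add, mul_add, add_re, add_re,
      show u ^ 2 * (σ * Y) = σ * (u ^ 2 * Y) by ring, re_ofReal_mul]
    ring
  have hell : ∀ σ : ℝ, |σ| = 1 → ‖2 * δ ^ 2 + (ζ 0 0 + ζ 1 1) + σ * Y‖
      ≤ 2 * ‖δ‖ ^ 2 + (h 0 + h 1) / 2 + σ * X := by
    intro σ hσ
    -- At this `u` the left side of `hval` is `P - ‖q‖`, and the right side is at least `mean -
    -- √disc ≥ 0`.
    obtain ⟨u, hu, huq⟩ := exists_sq_mul_eq_neg_norm (2 * δ ^ 2 + (ζ 0 0 + ζ 1 1) + σ * Y)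
    have h3 := hval σ u hu
    rw [huq, neg_re, ofReal_re] at h3
    have h4 := hpos u hu
    rw [hdisc u hu] at h4
    have h5 : |σ * (X + (u ^ 2 * Y).re)| = |X + (u ^ 2 * Y).re| := by rw [abs_mul, hσ, one_mul]
    have h6 := neg_abs_le (σ * (X + (u ^ 2 * Y).re))
    have h7 := sq_nonneg (u * δ).re
    linarith
  obtain ⟨E₁, hE₁, hE₁c, hE₁n, hE₁s⟩ := exists_ellipse_isSupport c (hell 1 (by simp))
  obtain ⟨E₂, hE₂, hE₂c, hE₂n, hE₂s⟩ := exists_ellipse_isSupport c (hell (-1) (by simp))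
  refine ⟨{E₁, E₂}, by simp, by simp, by simp [hE₁, hE₂], ?_⟩
  rw [sUnion_pair]
  refine isSupport_eq hW (s := fun u =>
      √((u * δ).re ^ 2 + (pencilMean h ζ (u ^ 2) + √(pencilDisc h ζ (u ^ 2))) / 4)) ?_ hc hcl
    (convex_convexHull ℝ _) (isCompact_convexHull_union hE₁c hE₂c hE₁n hE₂n).isClosed
  intro u hu
  have h3 := (hE₁s.union hE₂s).convexHull u hu
  convert h3 using 1
  beta_reduce
  rw [hval 1 u hu, hval (-1) u hu, hdisc u hu, ← Real.sqrt_monotone.map_max]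
  congr 1
  rcases le_total 0 (X + (u ^ 2 * Y).re) with h4 | h4
  · rw [abs_of_nonneg h4, max_eq_left (by linarith)]
    ring
  · rw [abs_of_nonpos h4, max_eq_right (by linarith)]
    ring

end

end Auxiliary

/-- Here `k = 2` and `n = m + 2`. The columns of the unitary matrix `U` are an orthonormal
eigenbasis of `H` with eigenvalues `h 0`, `h 1`, so `Uᴴ Z U` holds the entries of `Z` in that
basis; `z₁`, `z₂` are the eigenvalues of `Z` with multiplicity. -/
theorem mainTheorem1 (m : ℕ) (hm : 1 ≤ m) (α β : ℂ)
    (C : Matrix (Fin m) (Fin 2) ℂ) (D : Matrix (Fin 2) (Fin m) ℂ)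
    (U : Matrix (Fin 2) (Fin 2) ℂ) (hU : U ∈ Matrix.unitaryGroup (Fin 2) ℂ)
    (h : Fin 2 → ℝ)
    (hH : U.conjTranspose * matH C D * U = Matrix.diagonal fun i => (h i : ℂ))
    (z₁ z₂ : ℂ) (hz : (matZ C D).charpoly.roots = {z₁, z₂})
    (ζ : Matrix (Fin 2) (Fin 2) ℂ) (hζ : ζ = U.conjTranspose * matZ C D * U) :
    IsConvexHullOfEllipsesCenteredAt ((α + β) / 2) (numericalRange (scalarDiagBlock α β C D)) ↔
      (IsStarNormal (matZ C D) ∧ Commute (matZ C D) (matH C D)) ∨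
      (z₁ = z₂ ∧ ShareEigenvector (matZ C D) (matH C D)) ∨
      (z₁ ≠ z₂ ∧
        -((h 0 : ℂ) - (h 1 : ℂ)) ^ 2 * (ζ 0 1 * ζ 1 0 / (z₁ - z₂) ^ 2)
          = (((‖ζ 0 1‖ + ‖ζ 1 0‖) ^ 2 : ℝ) : ℂ)) := by
  rw [← discIsSquare_iff hU h hH z₁ z₂ hz ζ hζ]
  have hW := isSupport_numericalRange hm α β C D U hU h hH ζ hζ
  have hpos : ∀ u : ℂ, ‖u‖ = 1 → √(pencilDisc h ζ (u ^ 2)) ≤ pencilMean h ζ (u ^ 2) :=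
    fun u hu => sqrt_pencilDisc_le_pencilMean C D U h hH ζ hζ hu
  exact ⟨hW.discIsSquare fun u hu => (Real.sqrt_nonneg _).trans (hpos u hu),
    hW.isConvexHullOfEllipses (convex_setOf_inner _) (isCompact_setOf_inner _).isClosed hpos⟩
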